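/- **Setting.** Let $T>0$, let $\mathcal U\subseteq\mathbb R^{m}$ be convex, and let $f(x,u)=f_1(x)+f_2(x)u$ be bounded and Lipschitz on $\mathbb R^n\times\mathcal U$ with values in $\mathbb R^n$. A control signal on $[t,T)$ is a measurable $\mathbf u:[t,T)\to\mathcal U$, and $\xi=\xi^{\mathbf u}_{x,t}:[t,T]\to\mathbb R^n$ denotes the (absolutely continuous) solution of $\dot\xi=f(\xi,\mathbf u)$, $\xi(t)=x$. Let $\mathcal X\subseteq\mathbb R^n$ be a state space for this system, i.e. $\xi^{\mathbf u}_{x,t}$ stays in $\mathcal X$ on $[t,T]$ for all $x\in\mathcal X$, $t\in[0,T]$ and all control signals $\mathbf u$ (for instance $\mathcal X=\mathbb R^n$). Let $r:\mathcal X\times\mathcal U\to\mathbb R$ and $\phi:\mathcal X\to\mathbb R$ be bounded and Lipschitz, $r$ convex in $u$, and let $l:\mathcal X\to\mathbb R$ be Lipschitz (the safety constraint is $l\ge 0$). Put $$V_s(x,t)=\sup_{\mathbf u}\min_{\tau\in[t,T]} l(\xi^{\mathbf u}_{x,t}(\tau)).$$ For $(x,t)\in\mathcal X\times[0,T)$ the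 maximal set of safe controls is $$U_s^*(x,t)=\{u\in\mathcal U:\ \lim_{\varepsilon\to0^+}V_s(\xi^{u}_{x,t}(t+\varepsilon),t+\varepsilon)\ge 0\},$$ where $u$ is also used for the constant control signal. Let $$V(x,t)=\inf\Big\{\int_t^T r(\xi^{\mathbf u}_{x,t}(\tau),\mathbf u(\tau))\,d\tau+\phi(\xi^{\mathbf u}_{x,t}(T))\ :\ \mathbf u(\tau)\in U_s^*(\xi^{\mathbf u}_{x,t}(\tau),\tau)\ \ \forall\tau\in[t,T)\Big\}\in[-\infty,+\infty],$$ with $\inf\emptyset=+\infty$, and let $D$ be the set of all $(x,t)\in\mathcal X\times[0,T)$ with $U_s^*(x,t)\neq\emptyset$ (so $D=\mathcal X\times[0,T)$ if $U_s^*$ has nonempty values). **Theorem.** Assume that the set-valued map $(x,t)\mapsto U_s^*(x,t)$ is lower hemicontinuous on $\mathcal X\times[0,T)$. Then $V$ is a viscosity solution of the final-value problem $$\frac{\partial V}{\partial t}+\inf_{u\in U_s^*(x,t)}\{f(x,u)\cdot\nabla_xV+r(x,u)\}=0\quad\text{on }D,\qquad V(x,T)=\phi(x)\quad\text{for all }x\in\mathcal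 X.$$ That is: $V(x,T)=\phi(x)$ for all $x\in\mathcal X$; $V$ is finite, bounded and uniformly continuous on $D\cup(\mathcal X\times\{T\})$; and for every $(x_0,t_0)\in D$ and every real-valued $\psi$ that is $C^1$ in a neighbourhood of $(x_0,t_0)$ in $\mathbb R^n\times\mathbb R$, 1. if $V-\psi$ has a local maximum at $(x_0,t_0)$ relative to $\mathcal X\times[0,T]$, then $\partial_t\psi(x_0,t_0)+\inf_{u\in U_s^*(x_0,t_0)}\{f(x_0,u)\cdot\nabla_x\psi(x_0,t_0)+r(x_0,u)\}\ge 0$; 2. if $V-\psi$ has a local minimum at $(x_0,t_0)$ relative to $\mathcal X\times[0,T]$, then $\partial_t\psi(x_0,t_0)+\inf_{u\in U_s^*(x_0,t_0)}\{f(x_0,u)\cdot\nabla_x\psi(x_0,t_0)+r(x_0,u)\}\le 0$. -/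

import Mathlib

open Set Filter Topology

noncomputable section

/-- The control-affine dynamics `f(x,u) = f₁(x) + f₂(x) u`. -/
def affineDynamics {n m : ℕ}
    (f₁ : EuclideanSpace ℝ (Fin n) → EuclideanSpace ℝ (Fin n))
    (f₂ : EuclideanSpace ℝ (Fin n) → EuclideanSpace ℝ (Fin m) →L[ℝ] EuclideanSpace ℝ (Fin n))
    (x : EuclideanSpace ℝ (Fin n)) (u : EuclideanSpace ℝ (Fin m)) : EuclideanSpace ℝ (Fin n) :=
  f₁ x + f₂ x u

/-- `u` is a measurable control signal `[t,T) → U` and `ξ` is a state trajectory on `[t,T]` that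
starts from `x` at time `t` and evolves under `u`: it is the (absolutely continuous) solution of
`ξ' = f(ξ,u)`, written as an integral equation. -/
structure IsTrajectory {n m : ℕ}
    (f : EuclideanSpace ℝ (Fin n) → EuclideanSpace ℝ (Fin m) → EuclideanSpace ℝ (Fin n))
    (U : Set (EuclideanSpace ℝ (Fin m))) (T : ℝ) (x : EuclideanSpace ℝ (Fin n)) (t : ℝ)
    (u : ℝ → EuclideanSpace ℝ (Fin m)) (ξ : ℝ → EuclideanSpace ℝ (Fin n)) : Prop where
  measurable_control : Measurable u
  control_mem : ∀ τ ∈ Ico t T, u τ ∈ U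
  continuousOn : ContinuousOn ξ (Icc t T)
  integral_eq : ∀ τ ∈ Icc t T, ξ τ = x + ∫ s in t..τ, f (ξ s) (u s)

/-- `X` is a state space for the dynamics: for every control signal, the trajectory from a point
of `X` stays in `X` up to the final time. -/
def IsStateSpace {n m : ℕ}
    (f : EuclideanSpace ℝ (Fin n) → EuclideanSpace ℝ (Fin m) → EuclideanSpace ℝ (Fin n))
    (U : Set (EuclideanSpace ℝ (Fin m))) (T : ℝ) (X : Set (EuclideanSpace ℝ (Fin n))) : Prop :=
  ∀ x ∈ X, ∀ t ∈ Icc 0 T, ∀ u ξ, IsTrajectory f U T x t u ξ → ∀ τ ∈ Icc t T, ξ τ ∈ X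

/-- The safety value function `V_s(x,t) = sup_u min_{τ ∈ [t,T]} l(ξ(τ))`. -/
def safetyValue {n m : ℕ}
    (f : EuclideanSpace ℝ (Fin n) → EuclideanSpace ℝ (Fin m) → EuclideanSpace ℝ (Fin n))
    (U : Set (EuclideanSpace ℝ (Fin m))) (T : ℝ) (l : EuclideanSpace ℝ (Fin n) → ℝ)
    (x : EuclideanSpace ℝ (Fin n)) (t : ℝ) : ℝ :=
  sSup {c | ∃ u ξ, IsTrajectory f U T x t u ξ ∧ c = sInf ((fun τ => l (ξ τ)) '' Icc t T)}

/-- The maximal set of safe controls `U_s*(x,t)` for `t < T`: all `u ∈ U` for which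
`lim_{ε → 0+} V_s(ξ(t+ε), t+ε)` exists and is `≥ 0`, where `ξ` is the trajectory from `(x,t)`
under the constant control `u`. -/
def maxSafeControls {n m : ℕ}
    (f : EuclideanSpace ℝ (Fin n) → EuclideanSpace ℝ (Fin m) → EuclideanSpace ℝ (Fin n))
    (U : Set (EuclideanSpace ℝ (Fin m))) (T : ℝ) (l : EuclideanSpace ℝ (Fin n) → ℝ)
    (x : EuclideanSpace ℝ (Fin n)) (t : ℝ) : Set (EuclideanSpace ℝ (Fin m)) :=
  {u | u ∈ U ∧ ∃ ξ, IsTrajectory f U T x t (fun _ => u) ξ ∧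
    ∃ L : ℝ, 0 ≤ L ∧
      Tendsto (fun ε => safetyValue f U T l (ξ (t + ε)) (t + ε)) (𝓝[>] 0) (𝓝 L)}

/-- The value function of the control-constrained problem: the infimum of
`∫_t^T r(ξ,u) dτ + φ(ξ(T))` over the control signals with `u(τ) ∈ C(ξ(τ),τ)` for all
`τ ∈ [t,T)`. It is `⊤` when there is no such control signal. -/
def constrainedValue {n m : ℕ}
    (f : EuclideanSpace ℝ (Fin n) → EuclideanSpace ℝ (Fin m) → EuclideanSpace ℝ (Fin n))
    (U : Set (EuclideanSpace ℝ (Fin m))) (T : ℝ)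
    (r : EuclideanSpace ℝ (Fin n) → EuclideanSpace ℝ (Fin m) → ℝ)
    (φ : EuclideanSpace ℝ (Fin n) → ℝ)
    (C : EuclideanSpace ℝ (Fin n) → ℝ → Set (EuclideanSpace ℝ (Fin m)))
    (x : EuclideanSpace ℝ (Fin n)) (t : ℝ) : EReal :=
  sInf {c : EReal | ∃ u ξ, IsTrajectory f U T x t u ξ ∧ (∀ τ ∈ Ico t T, u τ ∈ C (ξ τ) τ) ∧
    c = (((∫ τ in t..T, r (ξ τ) (u τ)) + φ (ξ T) : ℝ) : EReal)}

/-- The Hamiltonian `inf_{u ∈ C(x,t)} { f(x,u) · p + r(x,u) }`, used only where `C(x,t)` is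
nonempty, `f` and `r` being bounded on it. -/
def hamiltonian {n m : ℕ}
    (f : EuclideanSpace ℝ (Fin n) → EuclideanSpace ℝ (Fin m) → EuclideanSpace ℝ (Fin n))
    (r : EuclideanSpace ℝ (Fin n) → EuclideanSpace ℝ (Fin m) → ℝ)
    (C : EuclideanSpace ℝ (Fin n) → ℝ → Set (EuclideanSpace ℝ (Fin m)))
    (x : EuclideanSpace ℝ (Fin n)) (t : ℝ) (p : EuclideanSpace ℝ (Fin n)) : ℝ :=
  sInf ((fun u => inner ℝ (f x u) p + r x u) '' C x t)

/-- The points of `X × [0,T]` at which the final-value problem is posed: all of `X × {T}`, and the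
points `(x,t)` with `t < T` at which the set `C(x,t)` of the minimisation is nonempty. It is all of
`X × [0,T]` when `C` has nonempty values. -/
def problemDomain {n m : ℕ} (X : Set (EuclideanSpace ℝ (Fin n))) (T : ℝ)
    (C : EuclideanSpace ℝ (Fin n) → ℝ → Set (EuclideanSpace ℝ (Fin m))) :
    Set (EuclideanSpace ℝ (Fin n) × ℝ) :=
  {p | p.1 ∈ X ∧ p.2 ∈ Icc 0 T ∧ (p.2 < T → (C p.1 p.2).Nonempty)}

/-- `V` is a viscosity solution of the final-value problem
`∂V/∂t + inf_{u ∈ C(x,t)} { f(x,u) · ∇ₓV + r(x,u) } = 0` for `t ∈ [0,T)`, `V(x,T) = φ(x)`. -/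
structure IsViscositySolution {n m : ℕ} (X : Set (EuclideanSpace ℝ (Fin n))) (T : ℝ)
    (f : EuclideanSpace ℝ (Fin n) → EuclideanSpace ℝ (Fin m) → EuclideanSpace ℝ (Fin n))
    (r : EuclideanSpace ℝ (Fin n) → EuclideanSpace ℝ (Fin m) → ℝ)
    (φ : EuclideanSpace ℝ (Fin n) → ℝ)
    (C : EuclideanSpace ℝ (Fin n) → ℝ → Set (EuclideanSpace ℝ (Fin m)))
    (V : EuclideanSpace ℝ (Fin n) → ℝ → EReal) : Prop where
  finite : ∀ p ∈ problemDomain X T C, V p.1 p.2 ≠ ⊤ ∧ V p.1 p.2 ≠ ⊥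
  bounded : ∃ M : ℝ, ∀ p ∈ problemDomain X T C, |(V p.1 p.2).toReal| ≤ M
  uniformContinuousOn :
    UniformContinuousOn (fun p : EuclideanSpace ℝ (Fin n) × ℝ => (V p.1 p.2).toReal)
      (problemDomain X T C)
  final : ∀ x ∈ X, V x T = (φ x : EReal)
  /-- The inequality at local maxima of `V - ψ`. -/
  of_localMax : ∀ x₀ ∈ X, ∀ t₀ ∈ Ico 0 T, (C x₀ t₀).Nonempty →
    ∀ ψ : EuclideanSpace ℝ (Fin n) × ℝ → ℝ, ContDiffAt ℝ 1 ψ (x₀, t₀) →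
      IsLocalMaxOn (fun p => V p.1 p.2 - (ψ p : EReal)) (X ×ˢ Icc 0 T) (x₀, t₀) →
      0 ≤ deriv (fun t => ψ (x₀, t)) t₀
        + hamiltonian f r C x₀ t₀ (gradient (fun x => ψ (x, t₀)) x₀)
  /-- The inequality at local minima of `V - ψ`. -/
  of_localMin : ∀ x₀ ∈ X, ∀ t₀ ∈ Ico 0 T, (C x₀ t₀).Nonempty →
    ∀ ψ : EuclideanSpace ℝ (Fin n) × ℝ → ℝ, ContDiffAt ℝ 1 ψ (x₀, t₀) →
      IsLocalMinOn (fun p => V p.1 p.2 - (ψ p : EReal)) (X ×ˢ Icc 0 T) (x₀, t₀) →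
      deriv (fun t => ψ (x₀, t)) t₀
        + hamiltonian f r C x₀ t₀ (gradient (fun x => ψ (x, t₀)) x₀) ≤ 0

end

/-! The safety constraint never selects among controls. By shadowing with the same control,
`safetyValue` is Lipschitz in `(x,t)`, hence continuous along every trajectory. The limit defining a
safe control is therefore the safety value at `(x,t)` itself, whatever the control, so the safe set
is all of `U` where that value is nonnegative and empty elsewhere (`mem_maxSafeControls_iff`).

Along a trajectory, the times with a nonempty safe set form a closed set by continuity of the safety
value, and an open set by lower hemicontinuity. As `[t,T)` is connected, a trajectory that starts
with safe controls has them up to `T` (`maxSafeControls_nonempty_trajectory`). On the problem domain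
the constraint is thus inactive, and the constrained value equals `freeValue`.

What remains is the classical argument: `freeValue` is bounded and Lipschitz and satisfies both
dynamic programming inequalities. Combined with a first-order expansion of the test function that is
uniform in the control (`eventually_abs_sub_integral_le`), these give the two viscosity
inequalities. Only points on trajectories from `(x₀,t₀)` enter, and these stay in the domain. -/

noncomputable section

open MeasureTheory

/-! ### Integral bounds, measurability along curves, and Grönwall's inequality -/

section IntervalIntegral

/-- The bound is asked on the open interval because controls lie in `U` only on `[t,T)`, and `b` may
be `T`. A single endpoint is null. -/
lemma norm_integral_le_of_forall_Ioo {E : Type*} [NormedAddCommGroup E] [NormedSpace ℝ E]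
    {a b : ℝ} (hab : a ≤ b) {g : ℝ → E} {C : ℝ → ℝ}
    (hC : IntervalIntegrable C volume a b) (h : ∀ s ∈ Ioo a b, ‖g s‖ ≤ C s) :
    ‖∫ s in a..b, g s‖ ≤ ∫ s in a..b, C s := by
  refine intervalIntegral.norm_integral_le_of_norm_le hab ?_ hC
  filter_upwards [volume.ae_ne b] with s hs hsab
  exact h s ⟨hsab.1, lt_of_le_of_ne hsab.2 hs⟩

lemma norm_integral_le_const_of_forall_Ioo {E : Type*} [NormedAddCommGroup E] [NormedSpace ℝ E]
    {a b : ℝ} (hab : a ≤ b) {g : ℝ → E} {C : ℝ}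
    (h : ∀ s ∈ Ioo a b, ‖g s‖ ≤ C) :
    ‖∫ s in a..b, g s‖ ≤ C * (b - a) := by
  refine (norm_integral_le_of_forall_Ioo hab intervalIntegrable_const h).trans_eq ?_
  simp [mul_comm]

/-- Composition of a bounded function that is continuous on `S` with a curve that is
continuous in its first component, measurable in its second, and takes values in `S`.
The set `S` need not be measurable. -/
lemma intervalIntegrable_comp_of_continuousOn {E : Type*} [NormedAddCommGroup E]
    [MeasurableSpace E] [BorelSpace E]
    [SecondCountableTopology E]
    {A B : Type*} [TopologicalSpace A] [MeasurableSpace A] [BorelSpace A]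
    [TopologicalSpace B] [MeasurableSpace B] [BorelSpace B]
    [SecondCountableTopology A] [SecondCountableTopology B]
    {S : Set (A × B)} {g : A × B → E} (hg : ContinuousOn g S) {M : ℝ}
    (hM : ∀ p ∈ S, ‖g p‖ ≤ M) {a b : ℝ} (hab : a ≤ b) {ξ : ℝ → A} {u : ℝ → B}
    (hξ : ContinuousOn ξ (Icc a b)) (hu : Measurable u) (hS : ∀ s ∈ Ioo a b, (ξ s, u s) ∈ S) :
    IntervalIntegrable (fun s => g (ξ s, u s)) volume a b := by
  rw [intervalIntegrable_iff_integrableOn_Ioo_of_le hab]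
  -- Seen as a map into the subtype `S`, the curve is measurable and `g` is continuous there, so no
  -- measurability of `S` is needed.
  have hmeas : Measurable (fun s : Ioo a b => g (ξ s, u s)) := by
    have h1 : Measurable (fun s : Ioo a b => (⟨(ξ s, u s), hS s s.2⟩ : S)) := by
      refine Measurable.subtype_mk (Measurable.prodMk ?_ (hu.comp measurable_subtype_coe))
      exact ((hξ.mono Ioo_subset_Icc_self).domRestrict).measurable
    exact (continuousOn_iff_continuous_domRestrict.1 hg).measurable.comp h1
  have hae : AEStronglyMeasurable (fun s => g (ξ s, u s)) (volume.restrict (Ioo a b)) := by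
    rw [← map_comap_subtype_coe measurableSet_Ioo,
      (MeasurableEmbedding.subtype_coe measurableSet_Ioo).aestronglyMeasurable_map_iff]
    exact hmeas.aestronglyMeasurable
  refine Integrable.of_bound hae M ?_
  exact (ae_restrict_iff' measurableSet_Ioo).2 (Eventually.of_forall fun s hs => hM _ (hS s hs))

/-- The differential form of Grönwall is applied to the majorant `δ + K ∫ v`: its right derivative
`K v` is at most `K` times the majorant. -/
lemma le_mul_exp_of_le_add_integral {v : ℝ → ℝ} {a b δ K : ℝ} (hK : 0 ≤ K)
    (hv : ContinuousOn v (Icc a b))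
    (h : ∀ τ ∈ Icc a b, v τ ≤ δ + K * ∫ s in a..τ, v s) :
    ∀ τ ∈ Icc a b, v τ ≤ δ * Real.exp (K * (τ - a)) := by
  intro τ hτ
  have hab : a ≤ b := hτ.1.trans hτ.2
  have hint : IntervalIntegrable v volume a b := hv.intervalIntegrable_of_Icc hab
  have key := le_gronwallBound_of_liminf_deriv_right_le
    (f := fun τ => δ + K * ∫ s in a..τ, v s) (f' := fun τ => K * v τ) (δ := δ) (K := K) (ε := 0)
    (a := a) (b := b) ?_ ?_ (by simp) ?_ τ hτ
  · rw [gronwallBound_ε0] at key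
    exact (h τ hτ).trans key
  · refine continuousOn_const.add (continuousOn_const.mul ?_)
    have := intervalIntegral.continuousOn_primitive_interval' hint left_mem_uIcc
    rwa [uIcc_of_le hab] at this
  · intro x hx r hr
    have hd : HasDerivWithinAt (fun τ => ∫ s in a..τ, v s) (v x) (Ici x) x := by
      have hmem : Icc a b ∈ 𝓝[>] x :=
        mem_of_superset (Ioo_mem_nhdsGT hx.2) fun y hy => ⟨hx.1.trans hy.1.le, hy.2.le⟩
      refine intervalIntegral.integral_hasDerivWithinAt_right (t := Ioi x)
        (hint.mono_set ?_) ?_ ?_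
      · rw [uIcc_of_le hx.1, uIcc_of_le hab]
        exact Icc_subset_Icc_right hx.2.le
      · exact ⟨Icc a b, hmem, (hv.aestronglyMeasurable measurableSet_Icc)⟩
      · exact (hv x ⟨hx.1, hx.2.le⟩).mono_of_mem_nhdsWithin hmem
    exact ((hd.const_mul K).const_add δ).liminf_right_slope_le hr
  · intro x hx
    rw [add_zero]
    exact mul_le_mul_of_nonneg_left (h x ⟨hx.1, hx.2.le⟩) hK

end IntervalIntegral

/-! ### Existence of trajectories by a weighted Picard iteration -/

section Existence

variable {n m : ℕ}
    {f : EuclideanSpace ℝ (Fin n) → EuclideanSpace ℝ (Fin m) → EuclideanSpace ℝ (Fin n)}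
    {U : Set (EuclideanSpace ℝ (Fin m))} {T M : ℝ} {K : NNReal}

lemma norm_sub_le_of_lipschitzOnWith_uncurry {A B G : Type*} [SeminormedAddCommGroup A]
    [PseudoMetricSpace B] [SeminormedAddCommGroup G] {g : A → B → G} {X : Set A} {U : Set B}
    {K : NNReal} (hL : LipschitzOnWith K (Function.uncurry g) (X ×ˢ U)) {x y : A} (hx : x ∈ X)
    (hy : y ∈ X) {w : B} (hw : w ∈ U) : ‖g x w - g y w‖ ≤ K * ‖x - y‖ := by
  have := hL.dist_le_mul (x, w) ⟨hx, hw⟩ (y, w) ⟨hy, hw⟩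
  simpa [Function.uncurry, dist_eq_norm, Prod.dist_eq] using this

/-- Existence of trajectories for measurable controls. -/
theorem exists_isTrajectory (hb : ∀ x, ∀ w ∈ U, ‖f x w‖ ≤ M)
    (hL : LipschitzOnWith K (Function.uncurry f) (univ ×ˢ U))
    {u : ℝ → EuclideanSpace ℝ (Fin m)} (hu : Measurable u) {t : ℝ} (htT : t ≤ T)
    (huU : ∀ τ ∈ Ico t T, u τ ∈ U) (x : EuclideanSpace ℝ (Fin n)) :
    ∃ ξ, IsTrajectory f U T x t u ξ := by
  -- In the unknown `η τ = exp (-c τ) ξ τ`, the Picard map contracts by `K / c = K / (K + 1)` on all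
  -- of `[t,T]` at once, so no gluing of short intervals is needed. Below, `w η` removes the weight.
  set c : ℝ := K + 1 with hc
  have hc0 : 0 < c := by positivity
  have hint : ∀ ζ : ℝ → EuclideanSpace ℝ (Fin n), ContinuousOn ζ (Icc t T) →
      IntervalIntegrable (fun s => f (ζ s) (u s)) volume t T := fun ζ hζ =>
    intervalIntegrable_comp_of_continuousOn (g := Function.uncurry f) hL.continuousOn (M := M)
      (fun p hp => hb p.1 p.2 hp.2) htT hζ hu fun s hs => ⟨mem_univ _, huU s ⟨hs.1.le, hs.2⟩⟩
  have hcont : ∀ ζ : ℝ → EuclideanSpace ℝ (Fin n), ContinuousOn ζ (Icc t T) →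
      ContinuousOn (fun τ => x + ∫ s in t..τ, f (ζ s) (u s)) (Icc t T) := by
    intro ζ hζ
    have := intervalIntegral.continuousOn_primitive_interval' (hint ζ hζ) left_mem_uIcc
    rw [uIcc_of_le htT] at this
    exact continuousOn_const.add this
  let w : C(Icc t T, EuclideanSpace ℝ (Fin n)) → ℝ → EuclideanSpace ℝ (Fin n) :=
    fun η s => Real.exp (c * s) • IccExtend htT η s
  have hw : ∀ η, Continuous (w η) := fun η => by
    have := η.continuous.Icc_extend' (h := htT)
    fun_prop
  let Φ : C(Icc t T, EuclideanSpace ℝ (Fin n)) → C(Icc t T, EuclideanSpace ℝ (Fin n)) :=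
    fun η => ⟨fun τ => Real.exp (-(c * τ)) • (x + ∫ s in t..τ, f (w η s) (u s)), by
      have := continuousOn_iff_continuous_domRestrict.1 (hcont _ (hw η).continuousOn)
      have h2 : Continuous fun τ : Icc t T => x + ∫ s in t..τ, f (w η s) (u s) := this
      fun_prop⟩
  have hΦ : ContractingWith (K / (K + 1)) Φ := by
    refine ⟨?_, ?_⟩
    · rw [div_lt_one (by positivity)]
      exact lt_add_one K
    · refine LipschitzWith.of_dist_le_mul fun η η' => ?_
      rw [ContinuousMap.dist_le (by positivity)]
      intro τ
      have hsub : uIcc t (τ : ℝ) ⊆ uIcc t T := by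
        rw [uIcc_of_le τ.2.1, uIcc_of_le htT]
        exact Icc_subset_Icc_right τ.2.2
      have h1 : Φ η τ - Φ η' τ = Real.exp (-(c * τ)) •
          ∫ s in t..τ, (f (w η s) (u s) - f (w η' s) (u s)) := by
        rw [intervalIntegral.integral_sub ((hint _ (hw η).continuousOn).mono_set hsub)
          ((hint _ (hw η').continuousOn).mono_set hsub)]
        simp only [Φ, ContinuousMap.coe_mk, ← smul_sub]
        congr 1
        abel
      have h2 : ‖∫ s in t..τ, (f (w η s) (u s) - f (w η' s) (u s))‖ ≤
          ∫ s in t..τ, (K * dist η η') * Real.exp (c * s) := by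
        refine norm_integral_le_of_forall_Ioo τ.2.1
          (Continuous.intervalIntegrable (by fun_prop) _ _) fun s hs => ?_
        refine (norm_sub_le_of_lipschitzOnWith_uncurry hL (mem_univ _) (mem_univ _)
          (huU s ⟨hs.1.le, hs.2.trans_le τ.2.2⟩)).trans ?_
        have h3 : ‖w η s - w η' s‖ ≤ Real.exp (c * s) * dist η η' := by
          simp only [w, ← smul_sub, norm_smul, Real.norm_eq_abs, Real.abs_exp]
          gcongr
          rw [← dist_eq_norm]
          exact ContinuousMap.dist_apply_le_dist _
        calc (K : ℝ) * ‖w η s - w η' s‖ ≤ K * (Real.exp (c * s) * dist η η') := by gcongr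
          _ = _ := by ring
      have h4 : ∫ s in t..τ, (K * dist η η') * Real.exp (c * s) ≤
          (K * dist η η') * (Real.exp (c * τ) / c) := by
        rw [intervalIntegral.integral_const_mul, intervalIntegral.integral_comp_mul_left _ hc0.ne',
          integral_exp, smul_eq_mul]
        gcongr
        rw [div_eq_inv_mul]
        gcongr
        linarith [Real.exp_pos (c * t)]
      rw [dist_eq_norm, h1, norm_smul, Real.norm_eq_abs, Real.abs_exp]
      calc Real.exp (-(c * τ)) * ‖∫ s in t..τ, (f (w η s) (u s) - f (w η' s) (u s))‖
          ≤ Real.exp (-(c * τ)) * ((K * dist η η') * (Real.exp (c * τ) / c)) := by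
            gcongr
            exact h2.trans h4
        _ = (Real.exp (-(c * τ)) * Real.exp (c * τ)) * (K / c * dist η η') := by ring
        _ = ((K / (K + 1) : NNReal) : ℝ) * dist η η' := by
          rw [← Real.exp_add, neg_add_cancel, Real.exp_zero, one_mul, hc]
          simp
  obtain ⟨η, hη⟩ : ∃ η, Φ η = η := ⟨_, hΦ.fixedPoint_isFixedPt⟩
  refine ⟨w η, hu, huU, (hw η).continuousOn, fun τ hτ => ?_⟩
  have := congrArg (fun g : C(Icc t T, EuclideanSpace ℝ (Fin n)) => g ⟨τ, hτ⟩) hη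
  simp only [Φ, ContinuousMap.coe_mk] at this
  simp only [w]
  rw [IccExtend_of_mem htT _ hτ, ← this, smul_smul, ← Real.exp_add, add_neg_cancel, Real.exp_zero,
    one_smul]

end Existence

/-! ### Speed bound, concatenation and stability of trajectories -/

section Trajectories

variable {n m : ℕ}
    {f : EuclideanSpace ℝ (Fin n) → EuclideanSpace ℝ (Fin m) → EuclideanSpace ℝ (Fin n)}
    {U : Set (EuclideanSpace ℝ (Fin m))} {T M : ℝ} {K : NNReal}
    {x y : EuclideanSpace ℝ (Fin n)} {t s : ℝ}
    {u v : ℝ → EuclideanSpace ℝ (Fin m)} {ξ η : ℝ → EuclideanSpace ℝ (Fin n)}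

namespace IsTrajectory

lemma apply_left (h : IsTrajectory f U T x t u ξ) (htT : t ≤ T) : ξ t = x := by
  simpa using h.integral_eq t ⟨le_rfl, htT⟩

lemma intervalIntegrable_comp {G : Type*} [NormedAddCommGroup G] [NormedSpace ℝ G]
    [MeasurableSpace G] [BorelSpace G] [SecondCountableTopology G]
    (h : IsTrajectory f U T x t u ξ) {X : Set (EuclideanSpace ℝ (Fin n))}
    {g : EuclideanSpace ℝ (Fin n) → EuclideanSpace ℝ (Fin m) → G} {C : ℝ}
    (hg : ContinuousOn (Function.uncurry g) (X ×ˢ U)) (hC : ∀ x ∈ X, ∀ w ∈ U, ‖g x w‖ ≤ C)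
    (hX : ∀ τ ∈ Icc t T, ξ τ ∈ X) {a b : ℝ} (ha : t ≤ a) (hab : a ≤ b) (hb : b ≤ T) :
    IntervalIntegrable (fun τ => g (ξ τ) (u τ)) volume a b :=
  intervalIntegrable_comp_of_continuousOn hg (fun p hp => hC p.1 hp.1 p.2 hp.2) hab
    (h.continuousOn.mono (Icc_subset_Icc ha hb)) h.measurable_control fun τ hτ =>
      ⟨hX τ ⟨ha.trans hτ.1.le, hτ.2.le.trans hb⟩,
        h.control_mem τ ⟨ha.trans hτ.1.le, hτ.2.trans_le hb⟩⟩

lemma intervalIntegrable (h : IsTrajectory f U T x t u ξ) (hM : ∀ x, ∀ w ∈ U, ‖f x w‖ ≤ M)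
    (hL : LipschitzOnWith K (Function.uncurry f) (univ ×ˢ U)) {a b : ℝ} (ha : t ≤ a)
    (hab : a ≤ b) (hb : b ≤ T) : IntervalIntegrable (fun τ => f (ξ τ) (u τ)) volume a b :=
  h.intervalIntegrable_comp hL.continuousOn (fun x _ => hM x) (fun _ _ => mem_univ _) ha hab hb

lemma sub_eq_integral (h : IsTrajectory f U T x t u ξ) (hM : ∀ x, ∀ w ∈ U, ‖f x w‖ ≤ M)
    (hL : LipschitzOnWith K (Function.uncurry f) (univ ×ˢ U)) {a b : ℝ} (ha : t ≤ a)
    (hab : a ≤ b) (hb : b ≤ T) : ξ b - ξ a = ∫ τ in a..b, f (ξ τ) (u τ) := by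
  rw [h.integral_eq b ⟨ha.trans hab, hb⟩, h.integral_eq a ⟨ha, hab.trans hb⟩,
    ← intervalIntegral.integral_add_adjacent_intervals
      (h.intervalIntegrable hM hL le_rfl ha (hab.trans hb)) (h.intervalIntegrable hM hL ha hab hb)]
  abel

lemma norm_sub_le (h : IsTrajectory f U T x t u ξ) (hM : ∀ x, ∀ w ∈ U, ‖f x w‖ ≤ M)
    (hL : LipschitzOnWith K (Function.uncurry f) (univ ×ˢ U)) {a b : ℝ} (ha : t ≤ a)
    (hab : a ≤ b) (hb : b ≤ T) : ‖ξ b - ξ a‖ ≤ M * (b - a) := by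
  rw [h.sub_eq_integral hM hL ha hab hb]
  exact norm_integral_le_const_of_forall_Ioo hab fun τ hτ =>
    hM _ _ (h.control_mem τ ⟨ha.trans hτ.1.le, hτ.2.trans_le hb⟩)

lemma restrict (h : IsTrajectory f U T x t u ξ) (hM : ∀ x, ∀ w ∈ U, ‖f x w‖ ≤ M)
    (hL : LipschitzOnWith K (Function.uncurry f) (univ ×ˢ U)) (hts : t ≤ s) :
    IsTrajectory f U T (ξ s) s u ξ where
  measurable_control := h.measurable_control
  control_mem τ hτ := h.control_mem τ ⟨hts.trans hτ.1, hτ.2⟩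
  continuousOn := h.continuousOn.mono (Icc_subset_Icc_left hts)
  integral_eq τ hτ := by
    rw [← h.sub_eq_integral hM hL hts hτ.1 hτ.2]
    abel

/-- Concatenation of two trajectories at time `s`. -/
lemma concat (h : IsTrajectory f U T x t u ξ) (h' : IsTrajectory f U T (ξ s) s v η)
    (hM : ∀ x, ∀ w ∈ U, ‖f x w‖ ≤ M)
    (hL : LipschitzOnWith K (Function.uncurry f) (univ ×ˢ U)) (hts : t ≤ s) (hsT : s ≤ T) :
    IsTrajectory f U T x t (fun τ => if τ < s then u τ else v τ)
      (fun τ => if τ ≤ s then ξ τ else η τ) := by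
  have hleft : ∀ τ ∈ Icc t s,
      x + ∫ σ in t..τ, f (if σ ≤ s then ξ σ else η σ) (if σ < s then u σ else v σ) = ξ τ := by
    intro τ hτ
    rw [h.integral_eq τ ⟨hτ.1, hτ.2.trans hsT⟩]
    congr 1
    refine intervalIntegral.integral_congr_Ioo_of_le hτ.1 fun σ hσ => ?_
    have : σ < s := hσ.2.trans_le hτ.2
    simp [this, this.le]
  have hright : ∀ τ ∈ Icc s T,
      ∫ σ in s..τ, f (if σ ≤ s then ξ σ else η σ) (if σ < s then u σ else v σ) =
        ∫ σ in s..τ, f (η σ) (v σ) := by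
    intro τ hτ
    refine intervalIntegral.integral_congr_Ioo_of_le hτ.1 fun σ hσ => ?_
    simp [hσ.1.not_ge, hσ.1.le.not_gt]
  refine ⟨Measurable.ite measurableSet_Iio h.measurable_control h'.measurable_control,
    fun τ hτ => ?_, ?_, fun τ hτ => ?_⟩
  · split_ifs with hs
    · exact h.control_mem τ hτ
    · exact h'.control_mem τ ⟨not_lt.1 hs, hτ.2⟩
  · refine ContinuousOn.if ?_ ?_ ?_
    · intro τ hτ
      have : τ = s := by simpa using frontier_Iic_subset s hτ.2
      rw [this, h'.apply_left hsT]
    · refine h.continuousOn.mono fun τ hτ => hτ.1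
    · refine h'.continuousOn.mono fun τ hτ => ⟨?_, hτ.1.2⟩
      have h1 : τ ∈ closure (Ioi s) := by
        have h2 := hτ.2
        simp only [not_le] at h2
        exact h2
      simpa using h1
  · rcases le_or_gt τ s with hs | hs
    · rw [if_pos hs, hleft τ ⟨hτ.1, hs⟩]
    · have hi1 : IntervalIntegrable
          (fun σ => f (if σ ≤ s then ξ σ else η σ) (if σ < s then u σ else v σ)) volume t s := by
        refine (h.intervalIntegrable hM hL le_rfl hts hsT).congr_ae ?_
        rw [uIoc_of_le hts]
        filter_upwards [ae_restrict_mem measurableSet_Ioc, (volume.restrict _).ae_ne s] with σ hσ h1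
        have : σ < s := lt_of_le_of_ne hσ.2 h1
        simp [this, this.le]
      have hi2 : IntervalIntegrable
          (fun σ => f (if σ ≤ s then ξ σ else η σ) (if σ < s then u σ else v σ)) volume s τ := by
        refine (h'.intervalIntegrable hM hL le_rfl hs.le hτ.2).congr_ae ?_
        rw [uIoc_of_le hs.le]
        filter_upwards [ae_restrict_mem measurableSet_Ioc] with σ hσ
        simp [hσ.1.not_ge, hσ.1.le.not_gt]
      rw [if_neg hs.not_ge, ← intervalIntegral.integral_add_adjacent_intervals hi1 hi2, ← add_assoc,
        hleft s ⟨hts, le_rfl⟩, hright τ ⟨hs.le, hτ.2⟩]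
      exact h'.integral_eq τ ⟨hs.le, hτ.2⟩

/-- With equal controls the velocities differ by at most `K ‖ξ - η‖`, so Grönwall applies. -/
lemma norm_sub_le_mul_exp (h : IsTrajectory f U T x t u ξ) (h' : IsTrajectory f U T y t v η)
    (hM : ∀ x, ∀ w ∈ U, ‖f x w‖ ≤ M)
    (hL : LipschitzOnWith K (Function.uncurry f) (univ ×ˢ U)) (huv : ∀ τ ∈ Ico t T, u τ = v τ) :
    ∀ τ ∈ Icc t T, ‖ξ τ - η τ‖ ≤ ‖x - y‖ * Real.exp (K * (τ - t)) := by
  have hcont := (h.continuousOn.sub h'.continuousOn).norm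
  refine le_mul_exp_of_le_add_integral K.2 hcont fun τ hτ => ?_
  have h1 : ξ τ - η τ = (x - y) + ∫ σ in t..τ, (f (ξ σ) (u σ) - f (η σ) (v σ)) := by
    rw [h.integral_eq τ hτ, h'.integral_eq τ hτ, intervalIntegral.integral_sub
      (h.intervalIntegrable hM hL le_rfl hτ.1 hτ.2) (h'.intervalIntegrable hM hL le_rfl hτ.1 hτ.2)]
    abel
  have hint : IntervalIntegrable (fun σ => ‖ξ σ - η σ‖) volume t τ :=
    (hcont.mono (Icc_subset_Icc_right hτ.2)).intervalIntegrable_of_Icc hτ.1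
  rw [h1, ← intervalIntegral.integral_const_mul]
  refine (norm_add_le _ _).trans (add_le_add le_rfl ?_)
  refine norm_integral_le_of_forall_Ioo hτ.1 (hint.const_mul _) fun σ hσ => ?_
  have hσ' : σ ∈ Ico t T := ⟨hσ.1.le, hσ.2.trans_le hτ.2⟩
  rw [← huv σ hσ']
  exact norm_sub_le_of_lipschitzOnWith_uncurry hL (mem_univ _) (mem_univ _) (h.control_mem σ hσ')

/-- A trajectory from `(x,t)` can be shadowed from `(y,s)` by using the same control on the
common time interval. -/
lemma exists_near (h : IsTrajectory f U T x t u ξ) (hM0 : 0 ≤ M) (hM : ∀ x, ∀ w ∈ U, ‖f x w‖ ≤ M)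
    (hL : LipschitzOnWith K (Function.uncurry f) (univ ×ˢ U)) (ht : t ∈ Icc 0 T)
    (hs : s ∈ Icc 0 T) (hU : s < T → U.Nonempty) (y : EuclideanSpace ℝ (Fin n)) :
    ∃ v η, IsTrajectory f U T y s v η ∧ (∀ τ, t ≤ τ → v τ = u τ) ∧
      ∀ τ ∈ Icc s T, ‖ξ (max τ t) - η τ‖ ≤ Real.exp (K * T) * (‖x - y‖ + M * |t - s|) := by
  -- `w` is played before time `t`, where `u` need not lie in `U`. For `s = T` the value `0` is a
  -- dummy.
  obtain ⟨w, hw⟩ : ∃ w, s < T → w ∈ U := by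
    by_cases hsT : s < T
    · obtain ⟨w, hw⟩ := hU hsT
      exact ⟨w, fun _ => hw⟩
    · exact ⟨0, fun h => absurd h hsT⟩
  have hv : Measurable (fun τ => if t ≤ τ then u τ else w) :=
    Measurable.ite measurableSet_Ici h.measurable_control measurable_const
  obtain ⟨η, hη⟩ := exists_isTrajectory hM hL hv hs.2 (fun τ hτ => by
    split_ifs with h1
    · exact h.control_mem τ ⟨h1, hτ.2⟩
    · exact hw (hτ.1.trans_lt hτ.2)) y
  refine ⟨_, η, hη, fun τ hτ => if_pos hτ, fun τ hτ => ?_⟩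
  have hδ : 0 ≤ ‖x - y‖ + M * |t - s| := by positivity
  have hexp : 1 ≤ Real.exp (K * T) :=
    Real.one_le_exp (mul_nonneg K.2 (ht.1.trans ht.2))
  have hηs := hη.apply_left hs.2
  have hξt := h.apply_left ht.2
  -- Before `t` the first trajectory is frozen at `x`, and only `η` has moved.
  rcases lt_or_ge τ t with hτt | hτt
  · rw [max_eq_right hτt.le, hξt]
    have h1 := hη.norm_sub_le hM hL le_rfl hτ.1 hτ.2
    rw [hηs] at h1
    have h2 : M * (τ - s) ≤ M * |t - s| := by
      gcongr
      exact (sub_le_sub_right hτt.le _).trans (le_abs_self _)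
    have h3 : ‖x - η τ‖ ≤ ‖x - y‖ + ‖η τ - y‖ := by
      rw [← norm_neg (η τ - y)]
      refine le_trans (le_of_eq ?_) (norm_add_le _ _)
      congr 1
      abel
    nlinarith
  · rw [max_eq_left hτt]
    -- From `a` on both trajectories run under the same control. Up to `a` only one of them has
    -- moved, for a time `|t - s|`.
    set a := max s t with ha
    have hta : t ≤ a := le_max_right _ _
    have hsa : s ≤ a := le_max_left _ _
    have haT : a ≤ T := max_le hs.2 ht.2
    have haτ : a ≤ τ := max_le hτ.1 hτt
    have h1 := (h.restrict hM hL hta).norm_sub_le_mul_exp (hη.restrict hM hL hsa) hM hL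
      (fun σ hσ => (if_pos (hta.trans hσ.1)).symm) τ ⟨haτ, hτ.2⟩
    have h2 : ‖ξ a - η a‖ ≤ ‖x - y‖ + M * |t - s| := by
      have h3 := h.norm_sub_le hM hL le_rfl hta haT
      have h4 := hη.norm_sub_le hM hL le_rfl hsa haT
      rw [hξt] at h3
      rw [hηs] at h4
      have h5 : ξ a - η a = (x - y) + ((ξ a - x) - (η a - y)) := by abel
      have h6 : (a - t) + (a - s) = |t - s| := by
        rcases le_total s t with hst | hst
        · rw [ha, max_eq_right hst, abs_of_nonneg (by linarith)]
          ring
        · rw [ha, max_eq_left hst, abs_of_nonpos (by linarith)]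
          ring
      rw [h5, ← h6, mul_add]
      exact (norm_add_le _ _).trans (add_le_add le_rfl ((_root_.norm_sub_le _ _).trans (add_le_add h3 h4)))
    have h7 : Real.exp (K * (τ - a)) ≤ Real.exp (K * T) := by
      have := hs.1.trans hsa
      gcongr
      linarith [hτ.2]
    calc ‖ξ τ - η τ‖ ≤ ‖ξ a - η a‖ * Real.exp (K * (τ - a)) := h1
      _ ≤ (‖x - y‖ + M * |t - s|) * Real.exp (K * T) := by gcongr
      _ = _ := mul_comm _ _

end IsTrajectory

end Trajectories

/-- Dynamics that are bounded by `M` and `K`-Lipschitz on `ℝⁿ × U`, with a state space `X`. -/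
structure IsRegularDynamics {n m : ℕ}
    (f : EuclideanSpace ℝ (Fin n) → EuclideanSpace ℝ (Fin m) → EuclideanSpace ℝ (Fin n))
    (U : Set (EuclideanSpace ℝ (Fin m))) (T : ℝ) (X : Set (EuclideanSpace ℝ (Fin n)))
    (M : ℝ) (K : NNReal) : Prop where
  nonneg : 0 ≤ M
  norm_le : ∀ x, ∀ w ∈ U, ‖f x w‖ ≤ M
  lipschitz : LipschitzOnWith K (Function.uncurry f) (univ ×ˢ U)
  stateSpace : IsStateSpace f U T X

/-! ### The safety value and the all-or-nothing structure of safe controls -/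

section Safety

variable {n m : ℕ}
    {f : EuclideanSpace ℝ (Fin n) → EuclideanSpace ℝ (Fin m) → EuclideanSpace ℝ (Fin n)}
    {U : Set (EuclideanSpace ℝ (Fin m))} {T M : ℝ} {K Kl : NNReal}
    {X : Set (EuclideanSpace ℝ (Fin n))} {l : EuclideanSpace ℝ (Fin n) → ℝ}
    {x y : EuclideanSpace ℝ (Fin n)} {t s : ℝ}
    {u : ℝ → EuclideanSpace ℝ (Fin m)} {ξ : ℝ → EuclideanSpace ℝ (Fin n)}

namespace IsRegularDynamics

/-- At `t = T` no control value is constrained, so `U` may be empty. The conditional hypothesis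
keeps this case, which the final condition needs. -/
lemma exists_trajectory (hf : IsRegularDynamics f U T X M K) (ht : t ≤ T)
    (hU : t < T → U.Nonempty) (x : EuclideanSpace ℝ (Fin n)) :
    ∃ u ξ, IsTrajectory f U T x t u ξ := by
  obtain ⟨w, hw⟩ : ∃ w, t < T → w ∈ U := by
    by_cases htT : t < T
    · obtain ⟨w, hw⟩ := hU htT
      exact ⟨w, fun _ => hw⟩
    · exact ⟨0, fun h => absurd h htT⟩
  exact ⟨fun _ => w, exists_isTrajectory hf.norm_le hf.lipschitz measurable_const ht
    (fun τ hτ => hw (hτ.1.trans_lt hτ.2)) x⟩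

lemma bddBelow_image (hf : IsRegularDynamics f U T X M K) (hl : LipschitzOnWith Kl l X)
    (hx : x ∈ X) (ht : t ∈ Icc 0 T) (h : IsTrajectory f U T x t u ξ) :
    BddBelow ((fun τ => l (ξ τ)) '' Icc t T) :=
  (isCompact_Icc.image_of_continuousOn (hl.continuousOn.comp h.continuousOn
    (hf.stateSpace x hx t ht u ξ h))).bddBelow

/-- Shadow a trajectory from `(x,t)` by one from `(y,s)`. Each time `τ` of the second is matched
with `max τ t` for the first, so the minima of `l` differ by at most `Kl` times the shadowing error.
-/
lemma safetyValue_le_add (hf : IsRegularDynamics f U T X M K) (hl : LipschitzOnWith Kl l X)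
    (hx : x ∈ X) (ht : t ∈ Icc 0 T) (hy : y ∈ X) (hs : s ∈ Icc 0 T)
    (hUt : t < T → U.Nonempty) (hUs : s < T → U.Nonempty) :
    safetyValue f U T l x t ≤
      safetyValue f U T l y s + Kl * (Real.exp (K * T) * (‖x - y‖ + M * |t - s|)) := by
  refine csSup_le ?_ ?_
  · obtain ⟨u, ξ, h⟩ := hf.exists_trajectory ht.2 hUt x
    exact ⟨_, u, ξ, h, rfl⟩
  · rintro _ ⟨u, ξ, h, rfl⟩
    obtain ⟨v, η, hη, -, hnear⟩ :=
      h.exists_near hf.nonneg hf.norm_le hf.lipschitz ht hs hUs y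
    have h1 : sInf ((fun τ => l (η τ)) '' Icc s T) ≤ safetyValue f U T l y s := by
      -- The minimum over `[s,T]` includes the initial time, so every competitor is at most `l y`.
      refine le_csSup ⟨l y, ?_⟩ ⟨v, η, hη, rfl⟩
      rintro _ ⟨v, η, hη, rfl⟩
      refine csInf_le (hf.bddBelow_image hl hy hs hη) ⟨s, ⟨le_rfl, hs.2⟩, ?_⟩
      simp only [hη.apply_left hs.2]
    rw [← sub_le_iff_le_add]
    refine le_trans (le_csInf ?_ ?_) h1
    · exact (nonempty_Icc.2 hs.2).image _
    · rintro _ ⟨τ, hτ, rfl⟩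
      have hmem : max τ t ∈ Icc t T := ⟨le_max_right _ _, max_le hτ.2 ht.2⟩
      have h2 : sInf ((fun τ => l (ξ τ)) '' Icc t T) ≤ l (ξ (max τ t)) :=
        csInf_le (hf.bddBelow_image hl hx ht h) ⟨_, hmem, rfl⟩
      have h3 := hl.dist_le_mul _ (hf.stateSpace x hx t ht u ξ h _ hmem) _
        (hf.stateSpace y hy s hs v η hη τ hτ)
      rw [Real.dist_eq, dist_eq_norm] at h3
      have h4 := mul_le_mul_of_nonneg_left (hnear τ hτ) Kl.2
      have h5 := le_abs_self (l (ξ (max τ t)) - l (η τ))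
      simp only [NNReal.val_eq_coe] at h4
      linarith

lemma abs_safetyValue_sub_le (hf : IsRegularDynamics f U T X M K) (hl : LipschitzOnWith Kl l X)
    (hx : x ∈ X) (ht : t ∈ Icc 0 T) (hy : y ∈ X) (hs : s ∈ Icc 0 T) (hU : U.Nonempty) :
    |safetyValue f U T l x t - safetyValue f U T l y s| ≤
      Kl * (Real.exp (K * T) * (‖x - y‖ + M * |t - s|)) := by
  have h1 := hf.safetyValue_le_add hl hx ht hy hs (fun _ => hU) (fun _ => hU)
  have h2 := hf.safetyValue_le_add hl hy hs hx ht (fun _ => hU) (fun _ => hU)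
  rw [norm_sub_rev, abs_sub_comm s t] at h2
  rw [abs_sub_le_iff]
  constructor <;> linarith

lemma continuousOn_safetyValue (hf : IsRegularDynamics f U T X M K)
    (hl : LipschitzOnWith Kl l X) (hU : U.Nonempty) :
    ContinuousOn (fun p : EuclideanSpace ℝ (Fin n) × ℝ => safetyValue f U T l p.1 p.2)
      (X ×ˢ Icc 0 T) := by
  intro p hp
  rw [ContinuousWithinAt, tendsto_iff_norm_sub_tendsto_zero]
  refine squeeze_zero' (Eventually.of_forall fun _ => norm_nonneg _)
    (g := fun q => Kl * (Real.exp (K * T) * (‖q.1 - p.1‖ + M * |q.2 - p.2|))) ?_ ?_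
  · filter_upwards [self_mem_nhdsWithin] with q hq
    exact hf.abs_safetyValue_sub_le hl hq.1 hq.2 hp.1 hp.2 hU
  · have : Continuous fun q : EuclideanSpace ℝ (Fin n) × ℝ =>
        (Kl : ℝ) * (Real.exp (K * T) * (‖q.1 - p.1‖ + M * |q.2 - p.2|)) := by fun_prop
    simpa using (this.tendsto p).mono_left nhdsWithin_le_nhds

lemma continuousOn_safetyValue_trajectory (hf : IsRegularDynamics f U T X M K)
    (hl : LipschitzOnWith Kl l X) (hU : U.Nonempty) (hx : x ∈ X) (ht : t ∈ Icc 0 T)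
    (h : IsTrajectory f U T x t u ξ) :
    ContinuousOn (fun τ => safetyValue f U T l (ξ τ) τ) (Icc t T) :=
  (hf.continuousOn_safetyValue hl hU).comp (h.continuousOn.prodMk continuousOn_id) fun τ hτ =>
    ⟨hf.stateSpace x hx t ht u ξ h τ hτ, ht.1.trans hτ.1, hτ.2⟩

/-- Since the safety value is continuous along trajectories, the safe controls are all controls
where it is nonnegative, and there are none elsewhere. -/
lemma mem_maxSafeControls_iff (hf : IsRegularDynamics f U T X M K) (hl : LipschitzOnWith Kl l X)
    (hx : x ∈ X) (ht : t ∈ Ico 0 T) {w : EuclideanSpace ℝ (Fin m)} :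
    w ∈ maxSafeControls f U T l x t ↔ w ∈ U ∧ 0 ≤ safetyValue f U T l x t := by
  have ht' : t ∈ Icc 0 T := ⟨ht.1, ht.2.le⟩
  have key : ∀ ξ, w ∈ U → IsTrajectory f U T x t (fun _ => w) ξ →
      Tendsto (fun ε => safetyValue f U T l (ξ (t + ε)) (t + ε)) (𝓝[>] 0)
        (𝓝 (safetyValue f U T l x t)) := by
    intro ξ hw h
    have h1 := hf.continuousOn_safetyValue_trajectory hl ⟨w, hw⟩ hx ht' h t ⟨le_rfl, ht.2.le⟩
    rw [ContinuousWithinAt, h.apply_left ht.2.le] at h1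
    refine h1.comp (tendsto_nhdsWithin_iff.2 ⟨?_, ?_⟩)
    · have : Continuous fun ε : ℝ => t + ε := by fun_prop
      simpa using (this.tendsto 0).mono_left nhdsWithin_le_nhds
    · filter_upwards [Ioo_mem_nhdsGT (sub_pos.2 ht.2)] with ε hε
      exact ⟨by linarith [hε.1], by linarith [hε.2]⟩
  constructor
  · rintro ⟨hw, ξ, h, L, hL, hlim⟩
    exact ⟨hw, tendsto_nhds_unique hlim (key ξ hw h) ▸ hL⟩
  · rintro ⟨hw, hpos⟩
    obtain ⟨ξ, h⟩ := exists_isTrajectory hf.norm_le hf.lipschitz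
      (measurable_const (a := w)) ht.2.le (fun _ _ => hw) x
    exact ⟨hw, ξ, h, _, hpos, key ξ hw h⟩

lemma maxSafeControls_nonempty_iff (hf : IsRegularDynamics f U T X M K)
    (hl : LipschitzOnWith Kl l X) (hx : x ∈ X) (ht : t ∈ Ico 0 T) :
    (maxSafeControls f U T l x t).Nonempty ↔ U.Nonempty ∧ 0 ≤ safetyValue f U T l x t := by
  constructor
  · rintro ⟨w, hw⟩
    rw [hf.mem_maxSafeControls_iff hl hx ht] at hw
    exact ⟨⟨w, hw.1⟩, hw.2⟩
  · rintro ⟨⟨w, hw⟩, hpos⟩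
    exact ⟨w, (hf.mem_maxSafeControls_iff hl hx ht).2 ⟨hw, hpos⟩⟩

lemma maxSafeControls_eq (hf : IsRegularDynamics f U T X M K)
    (hl : LipschitzOnWith Kl l X) (hx : x ∈ X) (ht : t ∈ Ico 0 T)
    (hne : (maxSafeControls f U T l x t).Nonempty) : maxSafeControls f U T l x t = U := by
  ext w
  rw [hf.mem_maxSafeControls_iff hl hx ht]
  exact and_iff_left ((hf.maxSafeControls_nonempty_iff hl hx ht).1 hne).2

/-- If the safe controls depend lower hemicontinuously on `(x,t)`, then every trajectory from a
point that has safe controls keeps having safe controls. -/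
lemma maxSafeControls_nonempty_trajectory (hf : IsRegularDynamics f U T X M K)
    (hl : LipschitzOnWith Kl l X)
    (hlhc : LowerHemicontinuousOn (fun p : EuclideanSpace ℝ (Fin n) × ℝ =>
      maxSafeControls f U T l p.1 p.2) (X ×ˢ Ico 0 T))
    (hx : x ∈ X) (ht : t ∈ Ico 0 T) (hne : (maxSafeControls f U T l x t).Nonempty)
    (h : IsTrajectory f U T x t u ξ) {τ : ℝ} (hτ : τ ∈ Ico t T) :
    (maxSafeControls f U T l (ξ τ) τ).Nonempty := by
  have ht' : t ∈ Icc 0 T := ⟨ht.1, ht.2.le⟩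
  have hmem : ∀ σ ∈ Ico t T, (ξ σ, σ) ∈ X ×ˢ Ico 0 T := fun σ hσ =>
    ⟨hf.stateSpace x hx t ht' u ξ h σ ⟨hσ.1, hσ.2.le⟩, ht.1.trans hσ.1, hσ.2⟩
  have hU := ((hf.maxSafeControls_nonempty_iff hl hx ht).1 hne).1
  have hiff : ∀ σ ∈ Ico t T, (maxSafeControls f U T l (ξ σ) σ).Nonempty ↔
      0 ≤ safetyValue f U T l (ξ σ) σ := fun σ hσ => by
    rw [hf.maxSafeControls_nonempty_iff hl (hmem σ hσ).1 (hmem σ hσ).2, and_iff_right hU]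
  have hξ : ContinuousOn (fun σ => (ξ σ, σ)) (Ico t T) :=
    (h.continuousOn.mono Ico_subset_Icc_self).prodMk continuousOn_id
  have := Subtype.preconnectedSpace (isPreconnected_Ico (a := t) (b := T))
  -- `A` is clopen in the connected interval `[t,T)` and contains `t`, so it is everything.
  let A : Set (Ico t T) := {σ | (maxSafeControls f U T l (ξ σ) σ).Nonempty}
  have hA : IsClopen A := by
    constructor
    · have hc : Continuous fun σ : Ico t T => safetyValue f U T l (ξ σ) σ :=
        continuousOn_iff_continuous_domRestrict.1
          ((hf.continuousOn_safetyValue_trajectory hl hU hx ht' h).mono Ico_subset_Icc_self)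
      have hAeq : A = {σ : Ico t T | 0 ≤ safetyValue f U T l (ξ σ) σ} := by
        ext σ
        exact hiff σ σ.2
      rw [hAeq]
      exact isClosed_le continuous_const hc
    · rw [isOpen_iff_mem_nhds]
      intro σ hσ
      -- Tested against the whole space, lower hemicontinuity says that nonemptiness is an open
      -- condition.
      have h1 := lowerHemicontinuousWithinAt_iff.1 (hlhc _ (hmem σ σ.2)) univ isOpen_univ
        (by simpa [A] using hσ)
      have h2 : Tendsto (fun ρ : Ico t T => (ξ ρ, (ρ : ℝ))) (𝓝 σ)
          (𝓝[X ×ˢ Ico 0 T] (ξ σ, (σ : ℝ))) :=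
        tendsto_nhdsWithin_iff.2
          ⟨(continuousOn_iff_continuous_domRestrict.1 hξ).tendsto σ,
            Eventually.of_forall fun ρ => hmem ρ ρ.2⟩
      filter_upwards [h2.eventually h1] with ρ hρ
      simpa [A] using hρ
  have hAne : A.Nonempty := ⟨⟨t, le_rfl, ht.2⟩, by
    change (maxSafeControls f U T l (ξ t) t).Nonempty
    rwa [h.apply_left ht.2.le]⟩
  have hτA : (⟨τ, hτ⟩ : Ico t T) ∈ A := by
    rw [hA.eq_univ hAne]
    trivial
  exact hτA

end IsRegularDynamics

end Safety

/-- The value function of the problem without control constraints. -/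
def freeValue {n m : ℕ}
    (f : EuclideanSpace ℝ (Fin n) → EuclideanSpace ℝ (Fin m) → EuclideanSpace ℝ (Fin n))
    (U : Set (EuclideanSpace ℝ (Fin m))) (T : ℝ)
    (r : EuclideanSpace ℝ (Fin n) → EuclideanSpace ℝ (Fin m) → ℝ)
    (φ : EuclideanSpace ℝ (Fin n) → ℝ) (x : EuclideanSpace ℝ (Fin n)) (t : ℝ) : ℝ :=
  sInf {c | ∃ u ξ, IsTrajectory f U T x t u ξ ∧ c = (∫ τ in t..T, r (ξ τ) (u τ)) + φ (ξ T)}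

/-- Running and final costs that are bounded by `C` and `L`-Lipschitz on `X × U` and `X`. -/
structure IsRegularCost {n m : ℕ} (X : Set (EuclideanSpace ℝ (Fin n)))
    (U : Set (EuclideanSpace ℝ (Fin m)))
    (r : EuclideanSpace ℝ (Fin n) → EuclideanSpace ℝ (Fin m) → ℝ)
    (φ : EuclideanSpace ℝ (Fin n) → ℝ) (C : ℝ) (L : NNReal) : Prop where
  nonneg : 0 ≤ C
  running_le : ∀ x ∈ X, ∀ w ∈ U, ‖r x w‖ ≤ C
  running_lipschitz : LipschitzOnWith L (Function.uncurry r) (X ×ˢ U)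
  final_le : ∀ x ∈ X, |φ x| ≤ C
  final_lipschitz : LipschitzOnWith L φ X

/-! ### The unconstrained value: regularity and dynamic programming -/

section Value

variable {n m : ℕ}
    {f : EuclideanSpace ℝ (Fin n) → EuclideanSpace ℝ (Fin m) → EuclideanSpace ℝ (Fin n)}
    {U : Set (EuclideanSpace ℝ (Fin m))} {T M C : ℝ} {K L : NNReal}
    {X : Set (EuclideanSpace ℝ (Fin n))}
    {r : EuclideanSpace ℝ (Fin n) → EuclideanSpace ℝ (Fin m) → ℝ}
    {φ : EuclideanSpace ℝ (Fin n) → ℝ}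
    {x y : EuclideanSpace ℝ (Fin n)} {t s : ℝ}
    {u : ℝ → EuclideanSpace ℝ (Fin m)} {ξ : ℝ → EuclideanSpace ℝ (Fin n)}

namespace IsRegularCost

lemma intervalIntegrable (hr : IsRegularCost X U r φ C L) (hf : IsRegularDynamics f U T X M K)
    (hx : x ∈ X) (ht : t ∈ Icc 0 T) (h : IsTrajectory f U T x t u ξ) {a b : ℝ} (ha : t ≤ a)
    (hab : a ≤ b) (hb : b ≤ T) : IntervalIntegrable (fun τ => r (ξ τ) (u τ)) volume a b :=
  h.intervalIntegrable_comp hr.running_lipschitz.continuousOn hr.running_le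
    (hf.stateSpace x hx t ht u ξ h) ha hab hb

lemma abs_integral_le (hr : IsRegularCost X U r φ C L) (hf : IsRegularDynamics f U T X M K)
    (hx : x ∈ X) (ht : t ∈ Icc 0 T) (h : IsTrajectory f U T x t u ξ) {a b : ℝ} (ha : t ≤ a)
    (hab : a ≤ b) (hb : b ≤ T) : |∫ τ in a..b, r (ξ τ) (u τ)| ≤ C * (b - a) :=
  norm_integral_le_const_of_forall_Ioo hab fun τ hτ => hr.running_le _
    (hf.stateSpace x hx t ht u ξ h τ ⟨ha.trans hτ.1.le, hτ.2.le.trans hb⟩) _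
    (h.control_mem τ ⟨ha.trans hτ.1.le, hτ.2.trans_le hb⟩)

lemma abs_cost_le (hr : IsRegularCost X U r φ C L) (hf : IsRegularDynamics f U T X M K)
    (hx : x ∈ X) (ht : t ∈ Icc 0 T) (h : IsTrajectory f U T x t u ξ) :
    |(∫ τ in t..T, r (ξ τ) (u τ)) + φ (ξ T)| ≤ C * T + C := by
  refine (abs_add_le _ _).trans (add_le_add ?_ ?_)
  · refine (hr.abs_integral_le hf hx ht h le_rfl ht.2 le_rfl).trans ?_
    have := hr.nonneg
    gcongr
    linarith [ht.1]
  · exact hr.final_le _ (hf.stateSpace x hx t ht u ξ h T ⟨ht.2, le_rfl⟩)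

lemma bddBelow_cost (hr : IsRegularCost X U r φ C L) (hf : IsRegularDynamics f U T X M K)
    (hx : x ∈ X) (ht : t ∈ Icc 0 T) :
    BddBelow {c | ∃ u ξ, IsTrajectory f U T x t u ξ ∧
      c = (∫ τ in t..T, r (ξ τ) (u τ)) + φ (ξ T)} := by
  refine ⟨-(C * T + C), ?_⟩
  rintro _ ⟨u, ξ, h, rfl⟩
  exact (abs_le.1 (hr.abs_cost_le hf hx ht h)).1

lemma freeValue_le (hr : IsRegularCost X U r φ C L) (hf : IsRegularDynamics f U T X M K)
    (hx : x ∈ X) (ht : t ∈ Icc 0 T) (h : IsTrajectory f U T x t u ξ) :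
    freeValue f U T r φ x t ≤ (∫ τ in t..T, r (ξ τ) (u τ)) + φ (ξ T) :=
  csInf_le (hr.bddBelow_cost hf hx ht) ⟨u, ξ, h, rfl⟩

lemma le_freeValue (hf : IsRegularDynamics f U T X M K)
    (ht : t ≤ T) (hU : t < T → U.Nonempty) {b : ℝ}
    (hb : ∀ u ξ, IsTrajectory f U T x t u ξ → b ≤ (∫ τ in t..T, r (ξ τ) (u τ)) + φ (ξ T)) :
    b ≤ freeValue f U T r φ x t := by
  refine le_csInf ?_ ?_
  · obtain ⟨u, ξ, h⟩ := hf.exists_trajectory ht hU x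
    exact ⟨_, u, ξ, h, rfl⟩
  · rintro _ ⟨u, ξ, h, rfl⟩
    exact hb u ξ h

lemma abs_freeValue_le (hr : IsRegularCost X U r φ C L) (hf : IsRegularDynamics f U T X M K)
    (hx : x ∈ X) (ht : t ∈ Icc 0 T) (hU : t < T → U.Nonempty) :
    |freeValue f U T r φ x t| ≤ C * T + C := by
  refine abs_le.2 ⟨le_freeValue hf ht.2 hU fun u ξ h =>
    (abs_le.1 (hr.abs_cost_le hf hx ht h)).1, ?_⟩
  obtain ⟨u, ξ, h⟩ := hf.exists_trajectory ht.2 hU x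
  exact (hr.freeValue_le hf hx ht h).trans (abs_le.1 (hr.abs_cost_le hf hx ht h)).2

lemma freeValue_final (hf : IsRegularDynamics f U T X M K) :
    freeValue f U T r φ x T = φ x := by
  have hset : {c | ∃ u ξ, IsTrajectory f U T x T u ξ ∧
      c = (∫ τ in T..T, r (ξ τ) (u τ)) + φ (ξ T)} = {φ x} := by
    ext c
    constructor
    · rintro ⟨u, ξ, h, rfl⟩
      simp [h.apply_left le_rfl]
    · rintro rfl
      obtain ⟨u, ξ, h⟩ := hf.exists_trajectory le_rfl (fun h => absurd h (lt_irrefl T)) x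
      exact ⟨u, ξ, h, by simp [h.apply_left le_rfl]⟩
  rw [freeValue, hset, csInf_singleton]

/-- Using the same control on the common interval, the shadowing error `δ` costs at most `L δ T` in
the running cost and `L δ` in the final cost. The part of `[t,T]` or `[s,T]` that is not shared
costs at most `C |t - s|`. -/
lemma freeValue_le_add (hr : IsRegularCost X U r φ C L) (hf : IsRegularDynamics f U T X M K)
    (hx : x ∈ X) (ht : t ∈ Icc 0 T) (hy : y ∈ X) (hs : s ∈ Icc 0 T)
    (hUt : t < T → U.Nonempty) (hUs : s < T → U.Nonempty) :
    freeValue f U T r φ y s ≤ freeValue f U T r φ x t +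
      (L * (T + 1) * (Real.exp (K * T) * (‖x - y‖ + M * |t - s|)) + C * |t - s|) := by
  rw [← sub_le_iff_le_add]
  refine le_freeValue hf ht.2 hUt fun u ξ h => ?_
  obtain ⟨v, η, hη, hvu, hnear⟩ := h.exists_near hf.nonneg hf.norm_le hf.lipschitz ht hs hUs y
  set δ := Real.exp (K * T) * (‖x - y‖ + M * |t - s|) with hδ
  have hδ0 : 0 ≤ δ := by
    have := hf.nonneg
    positivity
  set a := max s t with ha
  have hta : t ≤ a := le_max_right _ _
  have hsa : s ≤ a := le_max_left _ _
  have haT : a ≤ T := max_le hs.2 ht.2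
  have ha0 : 0 ≤ a := ht.1.trans hta
  have hξX := hf.stateSpace x hx t ht u ξ h
  have hηX := hf.stateSpace y hy s hs v η hη
  have h1 := hr.freeValue_le hf hy hs hη
  rw [← intervalIntegral.integral_add_adjacent_intervals
    (hr.intervalIntegrable hf hy hs hη le_rfl hsa haT)
    (hr.intervalIntegrable hf hy hs hη hsa haT le_rfl)] at h1
  rw [← intervalIntegral.integral_add_adjacent_intervals
    (hr.intervalIntegrable hf hx ht h le_rfl hta haT)
    (hr.intervalIntegrable hf hx ht h hta haT le_rfl)]
  have h2 := (abs_le.1 (hr.abs_integral_le hf hy hs hη le_rfl hsa haT)).2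
  have h3 := (abs_le.1 (hr.abs_integral_le hf hx ht h le_rfl hta haT)).1
  have h4 : C * (a - s) + C * (a - t) = C * |t - s| := by
    rw [← mul_add]
    congr 1
    rcases le_total s t with hst | hst
    · rw [ha, max_eq_right hst, abs_of_nonneg (by linarith)]
      ring
    · rw [ha, max_eq_left hst, abs_of_nonpos (by linarith)]
      ring
  have h5 : |(∫ τ in a..T, r (ξ τ) (u τ)) - ∫ τ in a..T, r (η τ) (v τ)| ≤ L * δ * T := by
    rw [← intervalIntegral.integral_sub (hr.intervalIntegrable hf hx ht h hta haT le_rfl)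
      (hr.intervalIntegrable hf hy hs hη hsa haT le_rfl), ← Real.norm_eq_abs]
    refine (norm_integral_le_const_of_forall_Ioo (C := L * δ) haT fun τ hτ => ?_).trans ?_
    · have hτt : t ≤ τ := hta.trans hτ.1.le
      have hτs : s ≤ τ := hsa.trans hτ.1.le
      rw [hvu τ hτt]
      refine (norm_sub_le_of_lipschitzOnWith_uncurry hr.running_lipschitz (hξX τ ⟨hτt, hτ.2.le⟩)
        (hηX τ ⟨hτs, hτ.2.le⟩) (h.control_mem τ ⟨hτt, hτ.2⟩)).trans ?_
      have := hnear τ ⟨hτs, hτ.2.le⟩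
      rw [max_eq_left hτt] at this
      gcongr
    · gcongr
      linarith
  have h6 : |φ (ξ T) - φ (η T)| ≤ L * δ := by
    have h7 := hr.final_lipschitz.dist_le_mul _ (hξX T ⟨ht.2, le_rfl⟩) _ (hηX T ⟨hs.2, le_rfl⟩)
    have h8 := hnear T ⟨hs.2, le_rfl⟩
    rw [max_eq_left ht.2] at h8
    rw [Real.dist_eq, dist_eq_norm] at h7
    exact h7.trans (mul_le_mul_of_nonneg_left h8 L.2)
  have h9 := (abs_le.1 h5).1
  have h10 := (abs_le.1 h6).1
  linarith

lemma abs_freeValue_sub_le (hr : IsRegularCost X U r φ C L) (hf : IsRegularDynamics f U T X M K)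
    (hx : x ∈ X) (ht : t ∈ Icc 0 T) (hy : y ∈ X) (hs : s ∈ Icc 0 T)
    (hUt : t < T → U.Nonempty) (hUs : s < T → U.Nonempty) :
    |freeValue f U T r φ x t - freeValue f U T r φ y s| ≤
      L * (T + 1) * (Real.exp (K * T) * (‖x - y‖ + M * |t - s|)) + C * |t - s| := by
  have h1 := hr.freeValue_le_add hf hx ht hy hs hUt hUs
  have h2 := hr.freeValue_le_add hf hy hs hx ht hUs hUt
  rw [norm_sub_rev, abs_sub_comm s t] at h2
  rw [abs_sub_le_iff]
  constructor <;> linarith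

/-- The dynamic programming inequality along an arbitrary trajectory. -/
lemma freeValue_le_integral_add (hr : IsRegularCost X U r φ C L)
    (hf : IsRegularDynamics f U T X M K) (hx : x ∈ X) (ht : t ∈ Icc 0 T)
    (h : IsTrajectory f U T x t u ξ) (hts : t ≤ s) (hsT : s ≤ T) :
    freeValue f U T r φ x t ≤ (∫ τ in t..s, r (ξ τ) (u τ)) + freeValue f U T r φ (ξ s) s := by
  rw [← sub_le_iff_le_add']
  refine le_freeValue hf hsT (fun hs => ⟨u s, h.control_mem s ⟨hts, hs⟩⟩) fun v η hη => ?_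
  have hc := h.concat hη hf.norm_le hf.lipschitz hts hsT
  have h1 := hr.freeValue_le hf hx ht hc
  have h2 : (if T ≤ s then ξ T else η T) = η T := by
    split_ifs with hs
    · obtain rfl : s = T := le_antisymm hsT hs
      rw [hη.apply_left le_rfl]
    · rfl
  rw [← intervalIntegral.integral_add_adjacent_intervals
    (hr.intervalIntegrable hf hx ht hc le_rfl hts hsT)
    (hr.intervalIntegrable hf hx ht hc hts hsT le_rfl), h2] at h1
  have h3 : ∫ τ in t..s, r (if τ ≤ s then ξ τ else η τ) (if τ < s then u τ else v τ) =
      ∫ τ in t..s, r (ξ τ) (u τ) :=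
    intervalIntegral.integral_congr_Ioo_of_le hts fun τ hτ => by simp [hτ.2, hτ.2.le]
  have h4 : ∫ τ in s..T, r (if τ ≤ s then ξ τ else η τ) (if τ < s then u τ else v τ) =
      ∫ τ in s..T, r (η τ) (v τ) :=
    intervalIntegral.integral_congr_Ioo_of_le hsT fun τ hτ => by
      simp [hτ.1.not_ge, hτ.1.le.not_gt]
  rw [h3, h4] at h1
  linarith

/-- The dynamic programming inequality along a nearly optimal trajectory. -/
lemma exists_integral_add_freeValue_lt (hr : IsRegularCost X U r φ C L)
    (hf : IsRegularDynamics f U T X M K) (hx : x ∈ X) (ht : t ∈ Icc 0 T)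
    (hU : t < T → U.Nonempty) {ε : ℝ} (hε : 0 < ε) (hts : t ≤ s) (hsT : s ≤ T) :
    ∃ u ξ, IsTrajectory f U T x t u ξ ∧
      (∫ τ in t..s, r (ξ τ) (u τ)) + freeValue f U T r φ (ξ s) s <
        freeValue f U T r φ x t + ε := by
  obtain ⟨u, ξ, h, hlt⟩ : ∃ u ξ, IsTrajectory f U T x t u ξ ∧
      (∫ τ in t..T, r (ξ τ) (u τ)) + φ (ξ T) < freeValue f U T r φ x t + ε := by
    by_contra! H
    linarith [le_freeValue hf ht.2 hU H]
  refine ⟨u, ξ, h, lt_of_le_of_lt ?_ hlt⟩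
  -- The tail of a nearly optimal trajectory is a competitor from `(ξ s, s)`.
  have h1 := hr.freeValue_le hf (hf.stateSpace x hx t ht u ξ h s ⟨hts, hsT⟩)
    ⟨ht.1.trans hts, hsT⟩ (h.restrict hf.norm_le hf.lipschitz hts)
  rw [← intervalIntegral.integral_add_adjacent_intervals
    (hr.intervalIntegrable hf hx ht h le_rfl hts hsT)
    (hr.intervalIntegrable hf hx ht h hts hsT le_rfl)]
  linarith

/-- Where every trajectory satisfies the control constraint, the constrained and the unconstrained
value agree. -/
lemma constrainedValue_eq_coe (hr : IsRegularCost X U r φ C L)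
    (hf : IsRegularDynamics f U T X M K) (hx : x ∈ X) (ht : t ∈ Icc 0 T)
    (hU : t < T → U.Nonempty)
    {S : EuclideanSpace ℝ (Fin n) → ℝ → Set (EuclideanSpace ℝ (Fin m))}
    (hS : ∀ u ξ, IsTrajectory f U T x t u ξ → ∀ τ ∈ Ico t T, u τ ∈ S (ξ τ) τ) :
    constrainedValue f U T r φ S x t = (freeValue f U T r φ x t : EReal) := by
  refine IsGLB.sInf_eq ⟨?_, fun b hb => ?_⟩
  · rintro _ ⟨u, ξ, h, -, rfl⟩
    exact EReal.coe_le_coe_iff.2 (hr.freeValue_le hf hx ht h)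
  · have hb' : ∀ u ξ, IsTrajectory f U T x t u ξ →
        b ≤ (((∫ τ in t..T, r (ξ τ) (u τ)) + φ (ξ T) : ℝ) : EReal) :=
      fun u ξ h => hb ⟨u, ξ, h, hS u ξ h, rfl⟩
    induction b with
    | bot => exact bot_le
    | coe b =>
      exact EReal.coe_le_coe_iff.2
        (le_freeValue hf ht.2 hU fun u ξ h => EReal.coe_le_coe_iff.1 (hb' u ξ h))
    | top =>
      obtain ⟨u, ξ, h⟩ := hf.exists_trajectory ht.2 hU x
      exact absurd (top_le_iff.1 (hb' u ξ h)) (EReal.coe_ne_top _)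

end IsRegularCost

end Value

/-! ### First-order expansion and the viscosity inequalities for the unconstrained value -/

section Viscosity

variable {n m : ℕ}
    {f : EuclideanSpace ℝ (Fin n) → EuclideanSpace ℝ (Fin m) → EuclideanSpace ℝ (Fin n)}
    {U : Set (EuclideanSpace ℝ (Fin m))} {T M C : ℝ} {K L : NNReal}
    {X : Set (EuclideanSpace ℝ (Fin n))}
    {r : EuclideanSpace ℝ (Fin n) → EuclideanSpace ℝ (Fin m) → ℝ}
    {φ : EuclideanSpace ℝ (Fin n) → ℝ}
    {x : EuclideanSpace ℝ (Fin n)} {t : ℝ}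

/-- The product carries the sup norm, so `M + 1` dominates both the state speed `M` and the unit
speed of time. Unlike `M`, it is always positive and can be divided by. -/
lemma IsRegularDynamics.norm_prod_sub_le (hf : IsRegularDynamics f U T X M K) (ht : t ≤ T)
    {u : ℝ → EuclideanSpace ℝ (Fin m)} {ξ : ℝ → EuclideanSpace ℝ (Fin n)}
    (h : IsTrajectory f U T x t u ξ) {ε : ℝ} (hε : 0 ≤ ε) (hεT : t + ε ≤ T) :
    ‖(ξ (t + ε), t + ε) - (x, t)‖ ≤ (M + 1) * ε := by
  have h1 := h.norm_sub_le hf.norm_le hf.lipschitz le_rfl (le_add_of_nonneg_right hε) hεT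
  rw [h.apply_left ht, add_sub_cancel_left] at h1
  have h2 := mul_nonneg hf.nonneg hε
  rw [Prod.mk_sub_mk, Prod.norm_mk, add_sub_cancel_left, Real.norm_of_nonneg hε]
  exact max_le (by linarith) (by linarith)

/-- A property that holds near `(x,t)` holds for a short time along all trajectories from
`(x,t)`, uniformly in the control. -/
lemma IsRegularDynamics.eventually_trajectory (hf : IsRegularDynamics f U T X M K)
    (hx : x ∈ X) (ht : t ∈ Ico 0 T) {P : EuclideanSpace ℝ (Fin n) × ℝ → Prop}
    (hP : ∀ᶠ p in 𝓝[X ×ˢ Icc 0 T] (x, t), P p) :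
    ∀ᶠ ε in 𝓝[>] (0 : ℝ), t + ε < T ∧
      ∀ u ξ, IsTrajectory f U T x t u ξ → P (ξ (t + ε), t + ε) := by
  obtain ⟨δ, hδ, hball⟩ := Metric.mem_nhdsWithin_iff.1 hP
  have hM := hf.nonneg
  have hδM : 0 < δ / (M + 1) := by positivity
  filter_upwards [Ioo_mem_nhdsGT hδM, Ioo_mem_nhdsGT (sub_pos.2 ht.2)] with ε h1 h2
  have hεT : t + ε < T := by linarith [h2.2]
  refine ⟨hεT, fun u ξ h => hball ⟨?_, ?_, ?_⟩⟩
  · rw [Metric.mem_ball, dist_eq_norm]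
    refine (hf.norm_prod_sub_le ht.2.le h h1.1.le hεT.le).trans_lt ?_
    rw [mul_comm]
    exact (lt_div_iff₀ (by positivity)).1 h1.2
  · exact hf.stateSpace x hx t ⟨ht.1, ht.2.le⟩ u ξ h _ ⟨by linarith [h1.1], hεT.le⟩
  · exact ⟨by linarith [h1.1, ht.1], hεT.le⟩

/-- First-order expansion of a test function plus the running cost along trajectories, uniformly
in the control. -/
lemma IsRegularCost.eventually_abs_sub_integral_le (hr : IsRegularCost X U r φ C L)
    (hf : IsRegularDynamics f U T X M K) (hx : x ∈ X) (ht : t ∈ Ico 0 T)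
    {ψ : EuclideanSpace ℝ (Fin n) × ℝ → ℝ} {D : EuclideanSpace ℝ (Fin n) × ℝ →L[ℝ] ℝ}
    (hψ : HasFDerivAt ψ D (x, t)) {c : ℝ} (hc : 0 < c) :
    ∀ᶠ ε in 𝓝[>] (0 : ℝ), ∀ u ξ, IsTrajectory f U T x t u ξ →
      IntervalIntegrable (fun τ => D (f x (u τ), 1) + r x (u τ)) volume t (t + ε) ∧
      |ψ (ξ (t + ε), t + ε) - ψ (x, t) + (∫ τ in t..(t + ε), r (ξ τ) (u τ))
        - ∫ τ in t..(t + ε), (D (f x (u τ), 1) + r x (u τ))| ≤ c * ε := by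
  have hM := hf.nonneg
  have ht' : t ∈ Icc 0 T := ⟨ht.1, ht.2.le⟩
  -- Over a displacement of at most `(M + 1) ε`, this Taylor remainder uses half of the error budget
  -- `c * ε`.
  have hψ' : ∀ᶠ p in 𝓝[X ×ˢ Icc 0 T] (x, t),
      ‖ψ p - ψ (x, t) - D (p - (x, t))‖ ≤ c / (2 * (M + 1)) * ‖p - (x, t)‖ :=
    (hψ.isLittleO.def (by positivity)).filter_mono nhdsWithin_le_nhds
  -- Freezing the state at `x` changes the integrand by at most `B ε`. The total `B ε²` fits into
  -- the other half of the budget once `ε < c / (2 (B + 1))`.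
  set B : ℝ := (‖D‖ * K + L) * M with hB
  have hB0 : 0 ≤ B := by positivity
  have hc' : 0 < c / (2 * (B + 1)) := by positivity
  filter_upwards [hf.eventually_trajectory hx ht hψ', Ioo_mem_nhdsGT hc'] with ε hε hεc u ξ h
  obtain ⟨hεT, hε⟩ := hε
  have hε0 : 0 ≤ ε := hεc.1.le
  have htε : t ≤ t + ε := by linarith
  have hX := hf.stateSpace x hx t ht' u ξ h
  have hU : ∀ τ ∈ Ioo t (t + ε), u τ ∈ U := fun τ hτ =>
    h.control_mem τ ⟨hτ.1.le, hτ.2.trans hεT⟩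
  have hfi := h.intervalIntegrable hf.norm_le hf.lipschitz le_rfl htε hεT.le
  have hri := hr.intervalIntegrable hf hx ht' h le_rfl htε hεT.le
  have hfxi : IntervalIntegrable (fun τ => f x (u τ)) volume t (t + ε) :=
    intervalIntegrable_comp_of_continuousOn (ξ := fun _ => x) hf.lipschitz.continuousOn
      (fun p hp => hf.norm_le p.1 p.2 hp.2) htε continuousOn_const h.measurable_control
      fun τ hτ => ⟨mem_univ _, hU τ hτ⟩
  have hrxi : IntervalIntegrable (fun τ => r x (u τ)) volume t (t + ε) :=
    intervalIntegrable_comp_of_continuousOn (ξ := fun _ => x) hr.running_lipschitz.continuousOn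
      (fun p hp => hr.running_le p.1 hp.1 p.2 hp.2) htε continuousOn_const h.measurable_control
      fun τ hτ => ⟨hx, hU τ hτ⟩
  have hDi : ∀ g : ℝ → EuclideanSpace ℝ (Fin n), IntervalIntegrable g volume t (t + ε) →
      IntervalIntegrable (fun τ => D (g τ, 1)) volume t (t + ε) ∧
      ∫ τ in t..(t + ε), D (g τ, 1) = D (∫ τ in t..(t + ε), g τ, ε) := by
    intro g hg
    obtain ⟨D₁, d, hsplit⟩ : ∃ (D₁ : EuclideanSpace ℝ (Fin n) →L[ℝ] ℝ) (d : ℝ),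
        ∀ v a, D (v, a) = D₁ v + a * d := by
      refine ⟨D.comp (ContinuousLinearMap.inl ℝ _ ℝ), D (0, 1), fun v a => ?_⟩
      rw [ContinuousLinearMap.comp_apply, ContinuousLinearMap.inl_apply, ← smul_eq_mul,
        ← map_smul, ← map_add]
      simp
    have h1 : IntervalIntegrable (fun τ => D₁ (g τ)) volume t (t + ε) :=
      ⟨D₁.integrable_comp hg.1, D₁.integrable_comp hg.2⟩
    simp only [hsplit]
    refine ⟨h1.add intervalIntegrable_const, ?_⟩
    rw [intervalIntegral.integral_add h1 intervalIntegrable_const,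
      D₁.intervalIntegral_comp_comm hg]
    simp
  refine ⟨(hDi _ hfxi).1.add hrxi, ?_⟩
  -- The space-time increment is the integral of `(f (ξ τ) (u τ), 1)`, so the linear term of the
  -- expansion is exactly an integral.
  have hincr : D ((ξ (t + ε), t + ε) - (x, t)) = ∫ τ in t..(t + ε), D (f (ξ τ) (u τ), 1) := by
    rw [(hDi _ hfi).2, ← h.sub_eq_integral hf.norm_le hf.lipschitz le_rfl htε hεT.le,
      h.apply_left ht.2.le, Prod.mk_sub_mk, add_sub_cancel_left]
  have hdiff : ‖∫ τ in t..(t + ε), ((D (f (ξ τ) (u τ), 1) + r (ξ τ) (u τ)) -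
      (D (f x (u τ), 1) + r x (u τ)))‖ ≤ B * ε * (t + ε - t) := by
    refine norm_integral_le_const_of_forall_Ioo htε fun τ hτ => ?_
    have hτT : τ ≤ T := hτ.2.le.trans hεT.le
    have h1 : ‖ξ τ - x‖ ≤ M * ε := by
      have h2 := h.norm_sub_le hf.norm_le hf.lipschitz le_rfl hτ.1.le hτT
      rw [h.apply_left ht.2.le] at h2
      refine h2.trans ?_
      gcongr
      linarith [hτ.2]
    have h3 := norm_sub_le_of_lipschitzOnWith_uncurry hf.lipschitz (mem_univ (ξ τ)) (mem_univ x)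
      (hU τ hτ)
    have h4 := norm_sub_le_of_lipschitzOnWith_uncurry hr.running_lipschitz
      (hX τ ⟨hτ.1.le, hτT⟩) hx (hU τ hτ)
    have h5 : ‖D (f (ξ τ) (u τ), 1) - D (f x (u τ), 1)‖ ≤ ‖D‖ * (K * ‖ξ τ - x‖) := by
      rw [← map_sub, Prod.mk_sub_mk, sub_self]
      refine (D.le_opNorm _).trans ?_
      gcongr
      simpa [Prod.norm_mk] using h3
    calc _ = ‖(D (f (ξ τ) (u τ), 1) - D (f x (u τ), 1)) + (r (ξ τ) (u τ) - r x (u τ))‖ := by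
          congr 1
          ring
      _ ≤ ‖D‖ * (K * ‖ξ τ - x‖) + L * ‖ξ τ - x‖ := (norm_add_le _ _).trans (add_le_add h5 h4)
      _ = (‖D‖ * K + L) * ‖ξ τ - x‖ := by ring
      _ ≤ (‖D‖ * K + L) * (M * ε) := by gcongr
      _ = B * ε := by ring
  rw [intervalIntegral.integral_sub ((hDi _ hfi).1.add hri) ((hDi _ hfxi).1.add hrxi),
    intervalIntegral.integral_add (hDi _ hfi).1 hri, ← hincr] at hdiff
  have hrem := (hε u ξ h).trans (mul_le_mul_of_nonneg_left
    (hf.norm_prod_sub_le ht.2.le h hε0 hεT.le) (by positivity))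
  have e1 : c / (2 * (M + 1)) * ((M + 1) * ε) = c / 2 * ε := by
    field_simp
  have e2 : B * ε * (t + ε - t) ≤ c / 2 * ε := by
    rw [add_sub_cancel_left]
    refine mul_le_mul_of_nonneg_right ?_ hε0
    have h1 := (lt_div_iff₀ (by positivity)).1 hεc.2
    nlinarith
  rw [e1] at hrem
  have h7 := norm_add_le_of_le hrem (hdiff.trans e2)
  rw [Real.norm_eq_abs] at h7
  refine le_trans (le_of_eq ?_) (h7.trans (le_of_eq (by ring)))
  congr 1
  ring

/-- At a local maximum of `V - ψ` along trajectories, where `V` is the unconstrained value. -/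
lemma IsRegularCost.nonneg_of_freeValue_sub_le (hr : IsRegularCost X U r φ C L)
    (hf : IsRegularDynamics f U T X M K) (hx : x ∈ X) (ht : t ∈ Ico 0 T)
    {ψ : EuclideanSpace ℝ (Fin n) × ℝ → ℝ} {D : EuclideanSpace ℝ (Fin n) × ℝ →L[ℝ] ℝ}
    (hψ : HasFDerivAt ψ D (x, t))
    (hmax : ∀ᶠ ε in 𝓝[>] (0 : ℝ), t + ε < T ∧ ∀ u ξ, IsTrajectory f U T x t u ξ →
      freeValue f U T r φ (ξ (t + ε)) (t + ε) - ψ (ξ (t + ε), t + ε) ≤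
        freeValue f U T r φ x t - ψ (x, t))
    {w : EuclideanSpace ℝ (Fin m)} (hw : w ∈ U) : 0 ≤ D (f x w, 1) + r x w := by
  refine le_of_forall_pos_le_add fun c hc => ?_
  obtain ⟨ε, ⟨⟨hεT, h1⟩, h2⟩, hε⟩ := ((hmax.and
    (hr.eventually_abs_sub_integral_le hf hx ht hψ hc)).and self_mem_nhdsWithin).exists
  -- Under the constant control `w` the frozen integrand is constant, and its integral is `ε` times
  -- the quantity to be bounded.
  obtain ⟨ξ, h⟩ := exists_isTrajectory hf.norm_le hf.lipschitz
    (measurable_const (a := w)) ht.2.le (fun _ _ => hw) x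
  have h3 := hr.freeValue_le_integral_add hf hx ⟨ht.1, ht.2.le⟩ h (by linarith : t ≤ t + ε) hεT.le
  have h4 := h1 _ ξ h
  have h5 := (abs_le.1 (h2 _ ξ h).2).2
  rw [intervalIntegral.integral_const, add_sub_cancel_left, smul_eq_mul] at h5
  have h6 : 0 ≤ ε * (D (f x w, 1) + r x w + c) := by linarith
  exact nonneg_of_mul_nonneg_right h6 hε

/-- At a local minimum of `V - ψ` along trajectories, where `V` is the unconstrained value. -/
lemma IsRegularCost.nonpos_of_le_freeValue_sub (hr : IsRegularCost X U r φ C L)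
    (hf : IsRegularDynamics f U T X M K) (hx : x ∈ X) (ht : t ∈ Ico 0 T) (hU : U.Nonempty)
    {ψ : EuclideanSpace ℝ (Fin n) × ℝ → ℝ} {D : EuclideanSpace ℝ (Fin n) × ℝ →L[ℝ] ℝ}
    (hψ : HasFDerivAt ψ D (x, t))
    (hmin : ∀ᶠ ε in 𝓝[>] (0 : ℝ), t + ε < T ∧ ∀ u ξ, IsTrajectory f U T x t u ξ →
      freeValue f U T r φ x t - ψ (x, t) ≤
        freeValue f U T r φ (ξ (t + ε)) (t + ε) - ψ (ξ (t + ε), t + ε))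
    {b : ℝ} (hb : ∀ w ∈ U, b ≤ D (f x w, 1) + r x w) : b ≤ 0 := by
  refine le_of_forall_pos_le_add fun c hc => ?_
  obtain ⟨ε, ⟨⟨hεT, h1⟩, h2⟩, hε⟩ := ((hmin.and
    (hr.eventually_abs_sub_integral_le hf hx ht hψ (half_pos hc))).and self_mem_nhdsWithin).exists
  have htε : t ≤ t + ε := by linarith
  -- The suboptimality is `c / 2 * ε`, proportional to `ε`, so that it stays small after division by
  -- `ε`. The control depends on `ε`, which is why the expansion must be uniform in it.
  obtain ⟨u, ξ, h, h3⟩ := hr.exists_integral_add_freeValue_lt hf hx ⟨ht.1, ht.2.le⟩ (fun _ => hU)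
    (mul_pos (half_pos hc) hε) htε hεT.le
  have h4 := h1 u ξ h
  obtain ⟨hint, h5⟩ := h2 u ξ h
  have h6 := (abs_le.1 h5).1
  have h7 : ε * b ≤ ∫ τ in t..(t + ε), (D (f x (u τ), 1) + r x (u τ)) := by
    have h8 := intervalIntegral.integral_mono_on_of_le_Ioo htε
      (intervalIntegrable_const (c := b)) hint
      fun τ hτ => hb _ (h.control_mem τ ⟨hτ.1.le, hτ.2.trans hεT⟩)
    rwa [intervalIntegral.integral_const, add_sub_cancel_left, smul_eq_mul] at h8
  have h9 : ε * b ≤ ε * (0 + c) := by linarith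
  exact le_of_mul_le_mul_left h9 hε

/-- Translates the derivative of `ψ` along `(v,1)`, which the expansions produce, into the time
derivative and gradient of `IsViscositySolution`. -/
lemma fderiv_apply_prod_one {E : Type*} [NormedAddCommGroup E] [InnerProductSpace ℝ E]
    [CompleteSpace E] {ψ : E × ℝ → ℝ} {D : E × ℝ →L[ℝ] ℝ} {x : E} {t : ℝ}
    (hψ : HasFDerivAt ψ D (x, t)) (v : E) :
    D (v, 1) = deriv (fun s => ψ (x, s)) t + inner ℝ v (gradient (fun y => ψ (y, t)) x) := by
  have h1 : HasFDerivAt (fun y => ψ (y, t)) (D.comp (ContinuousLinearMap.inl ℝ E ℝ)) x :=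
    hψ.comp x (hasFDerivAt_prodMk_left x t)
  have h2 : HasFDerivAt (fun s => ψ (x, s)) (D.comp (ContinuousLinearMap.inr ℝ E ℝ)) t :=
    hψ.comp t (hasFDerivAt_prodMk_right x t)
  rw [h2.hasDerivAt.deriv, real_inner_comm, ← InnerProductSpace.toDual_apply_apply,
    toDual_gradient, h1.fderiv]
  simp only [ContinuousLinearMap.comp_apply, ContinuousLinearMap.inl_apply,
    ContinuousLinearMap.inr_apply, ← map_add]
  simp

end Viscosity

/-! ### Transfer to the safety-constrained value -/

section SafeValue

variable {n m : ℕ}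
    {f : EuclideanSpace ℝ (Fin n) → EuclideanSpace ℝ (Fin m) → EuclideanSpace ℝ (Fin n)}
    {U : Set (EuclideanSpace ℝ (Fin m))} {T M C : ℝ} {K L Kl : NNReal}
    {X : Set (EuclideanSpace ℝ (Fin n))}
    {r : EuclideanSpace ℝ (Fin n) → EuclideanSpace ℝ (Fin m) → ℝ}
    {φ l : EuclideanSpace ℝ (Fin n) → ℝ}

lemma nonempty_of_mem_problemDomain
    {p : EuclideanSpace ℝ (Fin n) × ℝ}
    (hp : p ∈ problemDomain X T (maxSafeControls f U T l)) : p.2 < T → U.Nonempty := fun h =>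
  let ⟨w, hw⟩ := hp.2.2 h
  ⟨w, hw.1⟩

/-- On the problem domain the safety constraint is inactive. -/
lemma IsRegularCost.constrainedValue_maxSafeControls (hr : IsRegularCost X U r φ C L)
    (hf : IsRegularDynamics f U T X M K) (hl : LipschitzOnWith Kl l X)
    (hlhc : LowerHemicontinuousOn (fun p : EuclideanSpace ℝ (Fin n) × ℝ =>
      maxSafeControls f U T l p.1 p.2) (X ×ˢ Ico 0 T))
    {p : EuclideanSpace ℝ (Fin n) × ℝ}
    (hp : p ∈ problemDomain X T (maxSafeControls f U T l)) :
    constrainedValue f U T r φ (maxSafeControls f U T l) p.1 p.2 =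
      (freeValue f U T r φ p.1 p.2 : EReal) := by
  refine hr.constrainedValue_eq_coe hf hp.1 hp.2.1
    (nonempty_of_mem_problemDomain hp) fun u ξ h τ hτ => ?_
  have hpT : p.2 < T := hτ.1.trans_lt hτ.2
  have hne := hf.maxSafeControls_nonempty_trajectory hl hlhc hp.1 ⟨hp.2.1.1, hpT⟩ (hp.2.2 hpT) h hτ
  rw [hf.maxSafeControls_eq hl (hf.stateSpace _ hp.1 _ hp.2.1 u ξ h τ ⟨hτ.1, hτ.2.le⟩)
    ⟨hp.2.1.1.trans hτ.1, hτ.2⟩ hne]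
  exact h.control_mem τ hτ

theorem IsRegularCost.isViscositySolution (hr : IsRegularCost X U r φ C L)
    (hf : IsRegularDynamics f U T X M K) (hl : LipschitzOnWith Kl l X) (hT : 0 < T)
    (hlhc : LowerHemicontinuousOn (fun p : EuclideanSpace ℝ (Fin n) × ℝ =>
      maxSafeControls f U T l p.1 p.2) (X ×ˢ Ico 0 T)) :
    IsViscositySolution X T f r φ (maxSafeControls f U T l)
      (constrainedValue f U T r φ (maxSafeControls f U T l)) := by
  have hV : ∀ p ∈ problemDomain X T (maxSafeControls f U T l),
      constrainedValue f U T r φ (maxSafeControls f U T l) p.1 p.2 =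
        (freeValue f U T r φ p.1 p.2 : EReal) :=
    fun p hp => hr.constrainedValue_maxSafeControls hf hl hlhc hp
  have hU : ∀ p ∈ problemDomain X T (maxSafeControls f U T l), p.2 < T → U.Nonempty :=
    fun p hp => nonempty_of_mem_problemDomain hp
  -- Outside the domain the constrained value is `⊤`. The extremum conditions are read only along
  -- trajectories, which stay inside, so they become real inequalities for `freeValue`.
  have hdom : ∀ x ∈ X, ∀ t ∈ Ico 0 T, (maxSafeControls f U T l x t).Nonempty →
      ∀ u ξ, IsTrajectory f U T x t u ξ → ∀ τ ∈ Ico t T,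
        (ξ τ, τ) ∈ problemDomain X T (maxSafeControls f U T l) := by
    intro x hx t ht hne u ξ h τ hτ
    exact ⟨hf.stateSpace x hx t ⟨ht.1, ht.2.le⟩ u ξ h τ ⟨hτ.1, hτ.2.le⟩,
      ⟨ht.1.trans hτ.1, hτ.2.le⟩,
      fun _ => hf.maxSafeControls_nonempty_trajectory hl hlhc hx ht hne h hτ⟩
  refine ⟨fun p hp => ?_, ⟨C * T + C, fun p hp => ?_⟩, ?_, fun x hx => ?_, ?_, ?_⟩
  · rw [hV p hp]
    exact ⟨EReal.coe_ne_top _, EReal.coe_ne_bot _⟩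
  · rw [hV p hp, EReal.toReal_coe]
    exact hr.abs_freeValue_le hf hp.1 hp.2.1 (hU p hp)
  · set A : ℝ := L * (T + 1) * (Real.exp (K * T) * (1 + M)) + C with hA
    have hM := hf.nonneg
    have hC := hr.nonneg
    have hA0 : 0 ≤ A := by positivity
    refine LipschitzOnWith.uniformContinuousOn (K := A.toNNReal)
      (LipschitzOnWith.of_dist_le_mul fun p hp q hq => ?_)
    rw [hV p hp, hV q hq, EReal.toReal_coe, EReal.toReal_coe, Real.dist_eq,
      Real.coe_toNNReal A hA0]
    have h1 : ‖p.1 - q.1‖ ≤ dist p q := by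
      rw [← dist_eq_norm]
      exact le_max_left _ _
    have h2 : |p.2 - q.2| ≤ dist p q := by
      rw [← Real.dist_eq]
      exact le_max_right _ _
    calc _ ≤ _ := hr.abs_freeValue_sub_le hf hp.1 hp.2.1 hq.1 hq.2.1 (hU p hp) (hU q hq)
      _ ≤ L * (T + 1) * (Real.exp (K * T) * (dist p q + M * dist p q)) + C * dist p q := by gcongr
      _ = A * dist p q := by ring
  · have hp : (x, T) ∈ problemDomain X T (maxSafeControls f U T l) :=
      ⟨hx, ⟨hT.le, le_rfl⟩, fun h => absurd h (lt_irrefl T)⟩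
    rw [hV (x, T) hp, IsRegularCost.freeValue_final hf]
  · intro x hx t ht hne ψ hψ hmax
    have hD := (hψ.differentiableAt one_ne_zero).hasFDerivAt
    have hx0 : (x, t) ∈ problemDomain X T (maxSafeControls f U T l) :=
      ⟨hx, ⟨ht.1, ht.2.le⟩, fun _ => hne⟩
    rw [← neg_le_iff_add_nonneg']
    refine le_csInf (hne.image _) ?_
    rintro _ ⟨w, hw, rfl⟩
    have h1 : 0 ≤ fderiv ℝ ψ (x, t) (f x w, 1) + r x w := by
      refine hr.nonneg_of_freeValue_sub_le hf hx ht hD ?_ hw.1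
      filter_upwards [hf.eventually_trajectory hx ht hmax, self_mem_nhdsWithin] with ε hε hε0
      refine ⟨hε.1, fun u ξ h => ?_⟩
      have h2 := hε.2 u ξ h
      rw [hV _ (hdom x hx t ht hne u ξ h (t + ε) ⟨le_add_of_nonneg_right (le_of_lt hε0), hε.1⟩),
        hV _ hx0] at h2
      exact_mod_cast h2
    rw [fderiv_apply_prod_one hD] at h1
    linarith
  · intro x hx t ht hne ψ hψ hmin
    have hD := (hψ.differentiableAt one_ne_zero).hasFDerivAt
    have hx0 : (x, t) ∈ problemDomain X T (maxSafeControls f U T l) :=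
      ⟨hx, ⟨ht.1, ht.2.le⟩, fun _ => hne⟩
    -- Nearly optimal trajectories may use any control in `U`, so the Hamiltonian has to bound the
    -- integrand on all of `U`, not just on the safe set.
    have hCU := hf.maxSafeControls_eq hl hx ht hne
    refine hr.nonpos_of_le_freeValue_sub hf hx ht (hCU ▸ hne) hD ?_ fun w hw => ?_
    · filter_upwards [hf.eventually_trajectory hx ht hmin, self_mem_nhdsWithin] with ε hε hε0
      refine ⟨hε.1, fun u ξ h => ?_⟩
      have h2 := hε.2 u ξ h
      rw [hV _ (hdom x hx t ht hne u ξ h (t + ε) ⟨le_add_of_nonneg_right (le_of_lt hε0), hε.1⟩),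
        hV _ hx0] at h2
      exact_mod_cast h2
    · rw [fderiv_apply_prod_one hD, add_assoc, add_le_add_iff_left]
      refine csInf_le ?_ ⟨w, hCU.symm ▸ hw, rfl⟩
      -- Boundedness below is needed for the real `sInf` to be a lower bound: that of an unbounded
      -- set is the default `0`.
      refine ⟨-(M * ‖gradient (fun y => ψ (y, t)) x‖ + C), ?_⟩
      rintro _ ⟨v, hv, rfl⟩
      have h1 := abs_le.1 ((abs_real_inner_le_norm (f x v) (gradient (fun y => ψ (y, t)) x)).trans
        (mul_le_mul_of_nonneg_right (hf.norm_le x v hv.1) (norm_nonneg _)))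
      have h2 := abs_le.1 (hr.running_le x hx v hv.1)
      simp only
      linarith [h1.1, h2.1]

end SafeValue

end

theorem theorem2 {n m : ℕ}
    (X : Set (EuclideanSpace ℝ (Fin n))) (U : Set (EuclideanSpace ℝ (Fin m))) (T : ℝ) (hT : 0 < T)
    (f₁ : EuclideanSpace ℝ (Fin n) → EuclideanSpace ℝ (Fin n))
    (f₂ : EuclideanSpace ℝ (Fin n) → EuclideanSpace ℝ (Fin m) →L[ℝ] EuclideanSpace ℝ (Fin n))
    (r : EuclideanSpace ℝ (Fin n) → EuclideanSpace ℝ (Fin m) → ℝ)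
    (φ l : EuclideanSpace ℝ (Fin n) → ℝ)
    (hU : Convex ℝ U)
    (hf_bdd : ∃ M : ℝ, ∀ x, ∀ u ∈ U, ‖affineDynamics f₁ f₂ x u‖ ≤ M)
    (hf_lip : ∃ K, LipschitzOnWith K (Function.uncurry (affineDynamics f₁ f₂)) (univ ×ˢ U))
    (hX : IsStateSpace (affineDynamics f₁ f₂) U T X)
    (hr_bdd : ∃ M : ℝ, ∀ x ∈ X, ∀ u ∈ U, |r x u| ≤ M)
    (hr_lip : ∃ K, LipschitzOnWith K (Function.uncurry r) (X ×ˢ U))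
    (hr_conv : ∀ x ∈ X, ConvexOn ℝ U (r x))
    (hφ_bdd : ∃ M : ℝ, ∀ x ∈ X, |φ x| ≤ M)
    (hφ_lip : ∃ K, LipschitzOnWith K φ X)
    (hl_lip : ∃ K, LipschitzOnWith K l X)
    (hlhc : LowerHemicontinuousOn
      (fun p : EuclideanSpace ℝ (Fin n) × ℝ =>
        maxSafeControls (affineDynamics f₁ f₂) U T l p.1 p.2)
      (X ×ˢ Ico 0 T)) :
    IsViscositySolution X T (affineDynamics f₁ f₂) r φ
      (maxSafeControls (affineDynamics f₁ f₂) U T l)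
      (constrainedValue (affineDynamics f₁ f₂) U T r φ
        (maxSafeControls (affineDynamics f₁ f₂) U T l)) := by
  obtain ⟨M, hM⟩ := hf_bdd
  obtain ⟨K, hK⟩ := hf_lip
  obtain ⟨Mr, hMr⟩ := hr_bdd
  obtain ⟨Lr, hLr⟩ := hr_lip
  obtain ⟨Mφ, hMφ⟩ := hφ_bdd
  obtain ⟨Lφ, hLφ⟩ := hφ_lip
  obtain ⟨Kl, hKl⟩ := hl_lip
  -- The given bounds may be negative when `U` or `X` is empty, hence the maximum with `0` here and
  -- for the costs.
  have hf : IsRegularDynamics (affineDynamics f₁ f₂) U T X (max M 0) K :=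
    ⟨le_max_right _ _, fun x w hw => (hM x w hw).trans (le_max_left _ _), hK, hX⟩
  have hr : IsRegularCost X U r φ (max (max Mr Mφ) 0) (max Lr Lφ) :=
    ⟨le_max_right _ _,
      fun x hx w hw => (hMr x hx w hw).trans ((le_max_left _ _).trans (le_max_left _ _)),
      hLr.weaken (le_max_left _ _),
      fun x hx => (hMφ x hx).trans ((le_max_right _ _).trans (le_max_left _ _)),
      hLφ.weaken (le_max_right _ _)⟩
  exact hr.isViscositySolution hf hKl hT hlhc
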